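/- There is a universal constant $\varepsilon_0\in(0,\pi/6)$ such that the following holds for every $0<\varepsilon<\varepsilon_0$. Let $v_2\colon[0,\infty)\to\mathbb{R}\cup\{+\infty\}$ satisfy - (i$_2$) $\min_{r\ge 0}v_2(r)=v_2(1)=-1$ and $v_2(r)>-1$ for $r\ne 1$; - (ii$_2$) there is $r_0$ with $1<r_0<\sqrt2$ and $v_2(r)=0$ for all $r\ge r_0$ (any such $r_0$ is fixed); - (iii$_2$) $v_2(r)>\varepsilon^{-1}$ for all $r\in[0,1-\varepsilon]$; and let $v_3\colon[0,2\pi]\to\mathbb{R}$ satisfy - (i$_3$) $v_3(\theta)=v_3(2\pi-\theta)$ for all $\theta\in[0,2\pi]$; - (ii$_3$) $v_3(k\pi/2)=0$ for $k=1,2,3$, and $v_3(\theta)>0$ for $\theta\notin\{\pi/2,\pi,3\pi/2\}$; - (iii$_3$) $v_3(\theta)\ge 4(\pi/6-\varepsilon)^{-1}|\theta-\pi|$ for all $\theta\in[\pi-\varepsilon,\pi+\varepsilon]$, with equality only if $\theta=\pi$; - (iv$_3$) $v_3(\theta)>\frac{4}{(1-\varepsilon)^2}\big(\sqrt2+\tfrac12\big)^2$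 for all $\theta\in[0,2\pi]$ outside $[\pi/2-\varepsilon,\pi/2+\varepsilon]\cup[\pi-\varepsilon,\pi+\varepsilon]\cup[3\pi/2-\varepsilon,3\pi/2+\varepsilon]$. For a configuration $C_n=(x_1,\dots,x_n)\in(\mathbb{R}^2)^n$ define the energy $$\mathcal{F}(C_n)=\frac12\sum_{i\ne j}v_2(|x_i-x_j|)+\frac12\sum_{(i,j,k)}v_3(\theta_{i,j,k}),$$ where the second sum runs over the ordered triples $(i,j,k)$ of pairwise distinct indices such that $0<|x_i-x_j|\le r_0$ and $0<|x_i-x_k|\le r_0$, and $\theta_{i,j,k}\in[0,2\pi)$ is the angle from $x_j-x_i$ to $x_k-x_i$, measured clockwise. Then for every $n$ and every $C_n\in(\mathbb{R}^2)^n$, $$\mathcal{F}(C_n)\ge -2n+\lceil 2\sqrt n\rceil,$$ and equality holds only if some rigid motion of the plane maps all the points $x_1,\dots,x_n$ into $\mathbb{Z}^2$. -/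

import Mathlib

namespace Crystallization

/-- The Euclidean plane. -/
abbrev Plane : Type := EuclideanSpace ℝ (Fin 2)

/-- A vector of the plane, as a complex number. -/
noncomputable def toComplex (u : Plane) : ℂ := ⟨u 0, u 1⟩

/-- The angle at `y`, in `[0, 2π)`, swept out when the vector `x - y` is turned clockwise until it
has the direction of `z - y` (meaningful for `x ≠ y` and `z ≠ y`). -/
noncomputable def clockwiseAngle (x y z : Plane) : ℝ :=
  toIcoMod Real.two_pi_pos 0 (Complex.arg (toComplex (x - y) / toComplex (z - y)))

/-- The assumptions on the two-body potential `v₂ : [0, ∞) → ℝ ∪ {+∞}` with parameter `ε` and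
interaction range `r₀`. Only the values at `r ≥ 0` matter, and `min_eq` and `min_unique`
exclude the value `-∞` there. -/
structure IsTwoBodyPotential (ε r₀ : ℝ) (v₂ : ℝ → EReal) : Prop where
  min_eq : v₂ 1 = ((-1 : ℝ) : EReal)
  min_unique : ∀ r : ℝ, 0 ≤ r → r ≠ 1 → ((-1 : ℝ) : EReal) < v₂ r
  one_lt_range : 1 < r₀
  range_lt_sqrt_two : r₀ < √2
  eq_zero : ∀ r : ℝ, r₀ ≤ r → v₂ r = 0
  repulsive : ∀ r : ℝ, 0 ≤ r → r ≤ 1 - ε → ((ε⁻¹ : ℝ) : EReal) < v₂ r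

/-- The assumptions on the three-body potential `v₃ : [0, 2π] → ℝ` with parameter `ε`. Only the
values on `[0, 2π]` matter. -/
structure IsThreeBodyPotential (ε : ℝ) (v₃ : ℝ → ℝ) : Prop where
  symm : ∀ θ ∈ Set.Icc (0 : ℝ) (2 * Real.pi), v₃ θ = v₃ (2 * Real.pi - θ)
  zero_half_pi : v₃ (Real.pi / 2) = 0
  zero_pi : v₃ Real.pi = 0
  zero_three_half_pi : v₃ (3 * Real.pi / 2) = 0
  pos : ∀ θ ∈ Set.Icc (0 : ℝ) (2 * Real.pi),
    θ ≠ Real.pi / 2 → θ ≠ Real.pi → θ ≠ 3 * Real.pi / 2 → 0 < v₃ θ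
  slope : ∀ θ ∈ Set.Icc (Real.pi - ε) (Real.pi + ε),
    4 * (Real.pi / 6 - ε)⁻¹ * |θ - Real.pi| ≤ v₃ θ
  slope_strict : ∀ θ ∈ Set.Icc (Real.pi - ε) (Real.pi + ε),
    v₃ θ = 4 * (Real.pi / 6 - ε)⁻¹ * |θ - Real.pi| → θ = Real.pi
  large : ∀ θ ∈ Set.Icc (0 : ℝ) (2 * Real.pi),
    θ ∉ Set.Icc (Real.pi / 2 - ε) (Real.pi / 2 + ε) ∪ Set.Icc (Real.pi - ε) (Real.pi + ε) ∪
        Set.Icc (3 * Real.pi / 2 - ε) (3 * Real.pi / 2 + ε) →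
      4 / (1 - ε) ^ 2 * (√2 + 1 / 2) ^ 2 < v₃ θ

/-- Two points form a bond if they are different and their distance is at most `r₀`. -/
def IsBond (r₀ : ℝ) (x y : Plane) : Prop := x ≠ y ∧ dist x y ≤ r₀

open Classical in
/-- The two-body part of the energy: half the sum over all ordered pairs of distinct indices. -/
noncomputable def twoBodyEnergy (v₂ : ℝ → EReal) {n : ℕ} (C : Fin n → Plane) : EReal :=
  ((1 / 2 : ℝ) : EReal) * ∑ i, ∑ j, if i ≠ j then v₂ (dist (C i) (C j)) else 0

open Classical in
/-- The three-body part of the energy: half the sum over all ordered triples `(i, j, k)` with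
`j ≠ k` for which both `x_j` and `x_k` are bonded to `x_i`, of `v₃` of the bond angle at `x_i`. -/
noncomputable def threeBodyEnergy (v₃ : ℝ → ℝ) (r₀ : ℝ) {n : ℕ} (C : Fin n → Plane) : ℝ :=
  (1 / 2) * ∑ i, ∑ j, ∑ k,
    if j ≠ k ∧ IsBond r₀ (C i) (C j) ∧ IsBond r₀ (C i) (C k) then
      v₃ (clockwiseAngle (C j) (C i) (C k))
    else 0

/-- The configurational energy, with values in `ℝ ∪ {+∞}`. -/
noncomputable def energy (v₂ : ℝ → EReal) (v₃ : ℝ → ℝ) (r₀ : ℝ) {n : ℕ} (C : Fin n → Plane) :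
    EReal :=
  twoBodyEnergy v₂ C + ((threeBodyEnergy v₃ r₀ C : ℝ) : EReal)

/-- The square lattice `ℤ²` in the plane. -/
def squareLattice : Set Plane := {x | ∀ i, ∃ k : ℤ, x i = k}

end Crystallization

namespace Crystallization

open Finset

/-! Write `minEnergy n` for the bound `-2n + ⌈2√n⌉`. It does not increase with `n`, so by induction
a configuration that strictly loses energy when some particle is removed lies strictly above its
bound. Such a particle exists if two particles are within `1 - ε`
(`exists_subenergy_erase_lt_of_close`), or if a bond angle is not within `ε` of `π/2`, `π` or `3π/2`
(`exists_subenergy_erase_lt_of_bad_angle`). What remains is a bond graph that looks locally like the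
square lattice.

For it the core is `ceil_two_sqrt_le_of_nearly_square`. Directions up to sign are sorted into eight
classes, each a cone of opening `π/8` and its negative. Cones are convex, so successive bonds of one
class form chains that never close up. Each particle gets two chains whose classes differ by about a
quarter turn, with dummy chains where bonds are missing. Two chains of different classes share at
most one particle, and three classes cannot be pairwise a quarter turn apart. Hence the particles
are the edges of a simple triangle-free graph on the `P` chains, and Mantel's theorem gives `4n ≤
P²`, that is `P ≥ ⌈2√n⌉`. Counting chain ends gives `P ≤ 2n - #bonds + K`, where `K` counts the
nearly straight pairs of bonds split between two classes (`DirectionClasses.exists_card_bound`).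
When the cones are rotated at random, a pair with angular defect `g` contributes at most `8g/π` to
`K` on average. By the slope condition on `v₃`, a third of the three-body energy pays for this.

In the equality case the unused energy vanishes, so bonds have length `1` and angles are exact.
Strict subadditivity (`minEnergy_add_lt`) makes the bond graph connected, and one bond direction
then propagates to a whole lattice. -/

/-! ### Mantel's theorem -/

/-- **Mantel's theorem** for a family of edges `s(A i, B i)` indexed by `V`, without loops, multiple
edges and triangles, on a vertex set `L`. -/
theorem four_mul_card_le_sq_of_triangleFree {V L : Type*} [Fintype V] [Fintype L]
    (A B : V → L) (hne : ∀ i, A i ≠ B i)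
    (hinj : ∀ i j, s(A i, B i) = s(A j, B j) → i = j)
    (htri : ∀ i j k : V, ∀ x y z : L, s(A i, B i) = s(x, y) → s(A j, B j) = s(y, z) →
      s(A k, B k) = s(x, z) → False) :
    4 * Fintype.card V ≤ Fintype.card L ^ 2 := by
  classical
  obtain ⟨G, hG⟩ : ∃ G : SimpleGraph L,
    G = SimpleGraph.fromEdgeSet (Set.range fun i => s(A i, B i)) := ⟨_, rfl⟩
  have hadj : ∀ x y, G.Adj x y → ∃ i, s(A i, B i) = s(x, y) := by
    intro x y h
    rw [hG, SimpleGraph.fromEdgeSet_adj] at h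
    exact h.1
  have hfree : G.CliqueFree (2 + 1) := by
    intro s hs
    obtain ⟨x, y, z, hxy, hxz, hyz, -⟩ := SimpleGraph.is3Clique_iff.1 hs
    obtain ⟨i, hi⟩ := hadj _ _ hxy
    obtain ⟨j, hj⟩ := hadj _ _ hyz
    obtain ⟨k, hk⟩ := hadj _ _ hxz
    exact htri i j k x y z hi hj hk
  have hcard : Fintype.card V ≤ #G.edgeFinset := by
    rw [← Finset.card_univ]
    refine Finset.card_le_card_of_injOn (fun i => s(A i, B i)) ?_ ?_
    · intro i _
      simp only [SimpleGraph.coe_edgeFinset, SimpleGraph.mem_edgeSet, hG,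
        SimpleGraph.fromEdgeSet_adj]
      exact ⟨⟨i, rfl⟩, hne i⟩
    · intro i _ j _ h
      exact hinj i j h
  have hT := hfree.card_edgeFinset_le
  simp only at hT
  have h2 : (Fintype.card L % 2).choose 2 = 0 :=
    Nat.choose_eq_zero_of_lt (Nat.mod_lt _ two_pos)
  rw [h2] at hT
  have : 4 * #G.edgeFinset ≤ Fintype.card L ^ 2 := by
    have h3 : #G.edgeFinset ≤ Fintype.card L ^ 2 / 4 := by
      refine hT.trans ?_
      simp only [Nat.add_zero]
      norm_num
      exact Nat.div_le_div_right (Nat.sub_le _ _)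
    omega
  omega

/-! ### Direction classes and the counting of chains -/

/-- The direction classes of two perpendicular bonds differ by roughly a quarter turn. -/
def QuarterTurn (x : ZMod 8) : Prop := x = 3 ∨ x = 4 ∨ x = 5

theorem QuarterTurn.ne {q q' : ZMod 8} (h : QuarterTurn (q - q')) : q ≠ q' := by
  rintro rfl
  rw [sub_self] at h
  revert h
  unfold QuarterTurn
  decide

theorem QuarterTurn.symm {q q' : ZMod 8} (h : QuarterTurn (q - q')) : QuarterTurn (q' - q) := by
  revert h q q'
  unfold QuarterTurn
  decide

/-- A sum of two elements of `{3, 4, 5}` lies in `{6, 7, 0, 1, 2}` modulo `8`. This excludes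
triangles among genuine chains. -/
theorem not_quarterTurn_triangle {a b c : ZMod 8} (hab : QuarterTurn (a - b))
    (hbc : QuarterTurn (b - c)) (hac : QuarterTurn (a - c)) : False := by
  revert a b c
  unfold QuarterTurn
  decide

/-- A finite bond graph whose vertex displacements are sorted into eight direction classes: `R q i j`
says that the displacement from `i` to `j` lies in the cone of class `q`. -/
structure DirectionClasses {V : Type*} (B : V → V → Prop) (R : ZMod 8 → V → V → Prop) : Prop where
  symm : ∀ {i j}, B i j → B j i
  trans : ∀ {q i j k}, R q i j → R q j k → R q i k
  irrefl : ∀ {q i}, ¬ R q i i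
  unique : ∀ {q q' i j}, (R q i j ∨ R q j i) → (R q' i j ∨ R q' j i) → q = q'
  exists_class : ∀ {i j}, B i j → ∃ q, R q i j ∨ R q j i
  out_unique : ∀ {q i j k}, B i j → B i k → R q i j → R q i k → j = k
  in_unique : ∀ {q i j k}, B i j → B i k → R q j i → R q k i → j = k

namespace DirectionClasses

variable {V : Type*} {B : V → V → Prop} {R : ZMod 8 → V → V → Prop}

theorem of_transGen (h : DirectionClasses B R) {q : ZMod 8} {i j : V}
    (hij : Relation.TransGen (fun i j => B i j ∧ R q i j) i j) : R q i j := by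
  induction hij with
  | single h1 => exact h1.2
  | tail _ h2 ih => exact h.trans ih h2.2

/-- Each `R q` is a strict order, so a chain of bonds of class `q` cannot return and must stop in a
finite set. Its end then serves as a name for the chain. -/
theorem exists_end [Finite V] (h : DirectionClasses B R) (q : ZMod 8) (i : V) :
    ∃ e, Relation.ReflTransGen (fun i j => B i j ∧ R q i j) i e ∧ ∀ j, ¬ (B e j ∧ R q e j) := by
  let S : V → V → Prop := fun x y => Relation.TransGen (fun i j => B i j ∧ R q i j) y x
  have : IsTrans V S := ⟨fun a b c hab hbc => Relation.TransGen.trans hbc hab⟩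
  have : Std.Irrefl S := ⟨fun a ha => h.irrefl (h.of_transGen ha)⟩
  have hwf : WellFounded S := Finite.wellFounded_of_trans_of_irrefl S
  induction i using hwf.induction with
  | _ i ih =>
    by_cases hi : ∃ j, B i j ∧ R q i j
    · obtain ⟨j, hj⟩ := hi
      obtain ⟨e, he, he'⟩ := ih j (Relation.TransGen.single hj)
      exact ⟨e, Relation.ReflTransGen.head hj he, he'⟩
    · push Not at hi
      exact ⟨i, Relation.ReflTransGen.refl, fun j hj => hi j hj.1 hj.2⟩

/-- By `in_unique` a chain can be walked backwards in only one way, so of two vertices with the same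
end one lies on the way from the other. -/
theorem eq_or_related_of_common_end (h : DirectionClasses B R) {q : ZMod 8} {i j e : V}
    (hi : Relation.ReflTransGen (fun i j => B i j ∧ R q i j) i e)
    (hj : Relation.ReflTransGen (fun i j => B i j ∧ R q i j) j e) :
    i = j ∨ (R q i j ∨ R q j i) := by
  have key : ∀ {x y}, Relation.ReflTransGen (fun i j => B i j ∧ R q i j) x y → x = y ∨ R q x y := by
    intro x y hxy
    rcases Relation.reflTransGen_iff_eq_or_transGen.1 hxy with h1 | h1
    · exact Or.inl h1.symm
    · exact Or.inr (h.of_transGen h1)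
  have hi' := Relation.reflTransGen_swap.2 hi
  have hj' := Relation.reflTransGen_swap.2 hj
  have hU : Relator.RightUnique (Function.swap fun i j => B i j ∧ R q i j) := by
    intro a b c hb hc
    exact h.in_unique (h.symm hb.1) (h.symm hc.1) hb.2 hc.2
  rcases Relation.ReflTransGen.total_of_right_unique hU hi' hj' with h1 | h1
  · rcases key (Relation.reflTransGen_swap.1 h1) with h2 | h2
    · exact Or.inl h2.symm
    · exact Or.inr (Or.inr h2)
  · rcases key (Relation.reflTransGen_swap.1 h1) with h2 | h2
    · exact Or.inl h2
    · exact Or.inr (Or.inl h2)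

-- `Ref i` holds one bond for each axis at `i`, and `r i l` is the reference bond that `l` should
-- continue in a straight line. The last sum counts the bonds `l` for which this fails because `l`
-- and `r i l` fall into different classes.
open Classical in
theorem exists_card_bound [Fintype V] (h : DirectionClasses B R) (Ref : V → Finset V)
    (r : V → V → V)
    (hRef : ∀ i, (∃ a b, Ref i = {a, b} ∧ B i a ∧ B i b ∧
        ∀ q q', (R q i a ∨ R q a i) → (R q' i b ∨ R q' b i) → QuarterTurn (q - q')) ∨
      (∃ a, Ref i = {a} ∧ B i a) ∨ Ref i = ∅)
    (hr : ∀ i l, B i l → l ∉ Ref i → r i l ∈ Ref i) :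
    ∃ P : ℕ, 4 * Fintype.card V ≤ P ^ 2 ∧
      2 * P + ∑ i, #{j | B i j} ≤ 4 * Fintype.card V +
        2 * ∑ i, #{l | B i l ∧ l ∉ Ref i ∧
          ¬ ∃ q, (R q i l ∨ R q l i) ∧ (R q i (r i l) ∨ R q (r i l) i)} := by
  choose e he he' using h.exists_end
  have hRefB : ∀ i, ∀ l ∈ Ref i, B i l := by
    intro i l hl
    rcases hRef i with ⟨a, b, hab, ha, hb, -⟩ | ⟨a, hab, ha⟩ | hab
    · rw [hab] at hl
      simp only [mem_insert, mem_singleton] at hl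
      rcases hl with rfl | rfl <;> assumption
    · rw [hab, mem_singleton] at hl
      rwa [hl]
    · simp [hab] at hl
  have hRef2 : ∀ i, #(Ref i) ≤ 2 := by
    intro i
    rcases hRef i with ⟨a, b, hab, -⟩ | ⟨a, hab, ha⟩ | hab
    · rw [hab]; exact card_le_two
    · simp [hab]
    · simp [hab]
  have hlab : ∀ i, ∃ x y : V × ZMod 8 ⊕ V × Bool,
      (∃ q q', QuarterTurn (q - q') ∧ (∃ a, B i a ∧ (R q i a ∨ R q a i)) ∧
        (∃ a, B i a ∧ (R q' i a ∨ R q' a i)) ∧ x = Sum.inl (e q i, q) ∧ y = Sum.inl (e q' i, q')) ∨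
      (∃ q, (∃ a, B i a ∧ (R q i a ∨ R q a i)) ∧ x = Sum.inl (e q i, q) ∧
        y = Sum.inr (i, false) ∧ #(Ref i) ≤ 1) ∨
      (x = Sum.inr (i, true) ∧ y = Sum.inr (i, false) ∧ #(Ref i) = 0) := by
    intro i
    rcases hRef i with ⟨a, b, hab, ha, hb, hq⟩ | ⟨a, hab, ha⟩ | hab
    · obtain ⟨q, h1⟩ := h.exists_class ha
      obtain ⟨q', h2⟩ := h.exists_class hb
      exact ⟨_, _, Or.inl ⟨q, q', hq q q' h1 h2, ⟨a, ha, h1⟩, ⟨b, hb, h2⟩, rfl, rfl⟩⟩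
    · obtain ⟨q, h1⟩ := h.exists_class ha
      exact ⟨_, _, Or.inr (Or.inl ⟨q, ⟨a, ha, h1⟩, rfl, rfl, by simp [hab]⟩)⟩
    · exact ⟨_, _, Or.inr (Or.inr ⟨rfl, rfl, by simp [hab]⟩)⟩
  choose x y hxy using hlab
  -- `T1` holds the ends of the chains with at least one bond. `T2` supplies dummy labels: two for a
  -- vertex without reference bonds, one for a vertex with a single one.
  let T1 : Finset (V × ZMod 8) :=
    {z | (∃ l, B z.1 l ∧ R z.2 l z.1) ∧ ¬ ∃ j, B z.1 j ∧ R z.2 z.1 j}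
  let T2 : Finset (V × Bool) := {z | #(Ref z.1) = 0 ∨ (#(Ref z.1) ≤ 1 ∧ z.2 = false)}
  have hmem1 : ∀ i q, (∃ a, B i a ∧ (R q i a ∨ R q a i)) →
      (Sum.inl (e q i, q) : V × ZMod 8 ⊕ V × Bool) ∈ T1.disjSum T2 := by
    intro i q ⟨a, ha, hq⟩
    rw [inl_mem_disjSum, mem_filter]
    refine ⟨mem_univ _, ?_, fun ⟨j, hj⟩ => he' q i j hj⟩
    rcases Relation.ReflTransGen.cases_tail (he q i) with h1 | ⟨c, -, h1⟩
    · simp only [h1]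
      rcases hq with hq | hq
      · have h2 := he' q i a
        rw [h1] at h2
        exact absurd ⟨ha, hq⟩ h2
      · exact ⟨a, ha, hq⟩
    · exact ⟨c, h.symm h1.1, h1.2⟩
  have hxT : ∀ i, x i ∈ T1.disjSum T2 := by
    intro i
    rcases hxy i with ⟨q, q', -, h1, -, h2, -⟩ | ⟨q, h1, h2, -, h3⟩ | ⟨h2, h1, h3⟩
    · rw [h2]; exact hmem1 i q h1
    · rw [h2]; exact hmem1 i q h1
    · rw [h2, inr_mem_disjSum, mem_filter]; exact ⟨mem_univ _, Or.inl h3⟩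
  have hyT : ∀ i, y i ∈ T1.disjSum T2 := by
    intro i
    rcases hxy i with ⟨q, q', -, -, h1, -, h2⟩ | ⟨q, h1, -, h2, h3⟩ | ⟨h1, h2, h3⟩
    · rw [h2]; exact hmem1 i q' h1
    · rw [h2, inr_mem_disjSum, mem_filter]; exact ⟨mem_univ _, Or.inr ⟨h3, rfl⟩⟩
    · rw [h2, inr_mem_disjSum, mem_filter]; exact ⟨mem_univ _, Or.inl h3⟩
  have hinr : ∀ i z u, s(x i, y i) = s(Sum.inr z, u) → z.1 = i := by
    intro i z u hz
    have hz' : (Sum.inr z : V × ZMod 8 ⊕ V × Bool) ∈ s(x i, y i) := by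
      rw [hz]; exact Sym2.mem_mk_left _ _
    rw [Sym2.mem_iff] at hz'
    rcases hxy i with ⟨q, q', -, -, -, h1, h2⟩ | ⟨q, -, h1, h2, -⟩ | ⟨h1, h2, -⟩ <;>
      rw [h1, h2] at hz' <;> simp at hz'
    · rw [hz']
    · rcases hz' with hz' | hz' <;> rw [hz']
  have hinl : ∀ i v q v' q', s(x i, y i) = s(Sum.inl (v, q), Sum.inl (v', q')) →
      QuarterTurn (q - q') ∧ v = e q i ∧ v' = e q' i := by
    intro i v q v' q' hz
    rw [Sym2.eq_iff] at hz
    rcases hxy i with ⟨p, p', hp, -, -, h1, h2⟩ | ⟨p, -, h1, h2, -⟩ | ⟨h1, h2, -⟩ <;>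
      rw [h1, h2] at hz <;> simp at hz
    rcases hz with ⟨⟨h3, h4⟩, h5, h6⟩ | ⟨⟨h3, h4⟩, h5, h6⟩
    · subst h4 h6
      exact ⟨hp, h3.symm, h5.symm⟩
    · subst h4 h6
      exact ⟨hp.symm, h5.symm, h3.symm⟩
  have hcommon : ∀ i j q, e q i = e q j → i ≠ j → R q i j ∨ R q j i := by
    intro i j q h1 hij
    exact (h.eq_or_related_of_common_end (h1 ▸ he q i) (he q j)).resolve_left hij
  have hM : 4 * Fintype.card V ≤ #(T1.disjSum T2) ^ 2 := by
    have hval : ∀ (a b c d : ↥(T1.disjSum T2)), s(a, b) = s(c, d) →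
        s(a.1, b.1) = s(c.1, d.1) := by
      intro a b c d habcd
      exact congrArg (Sym2.map Subtype.val) habcd
    rw [← Fintype.card_coe (T1.disjSum T2)]
    refine four_mul_card_le_sq_of_triangleFree (L := ↥(T1.disjSum T2)) (fun i => ⟨x i, hxT i⟩)
      (fun i => ⟨y i, hyT i⟩) ?_ ?_ ?_
    · intro i hi
      rw [Subtype.mk.injEq] at hi
      rcases hxy i with ⟨q, q', hp, -, -, h1, h2⟩ | ⟨q, -, h1, h2, -⟩ | ⟨h1, h2, -⟩ <;>
        rw [h1, h2] at hi <;> simp at hi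
      exact hp.ne hi.2
    · intro i j hij
      have hij := hval _ _ _ _ hij
      simp only at hij
      rcases hxj : x j with ⟨v, q⟩ | z
      · rcases hyj : y j with ⟨v', q'⟩ | z
        · have h1 := hinl j v q v' q' (by rw [hxj, hyj])
          have h2 := hinl i v q v' q' (by rw [hij, hxj, hyj])
          -- Two vertices sharing both chains would have a displacement lying in two distinct
          -- classes.
          by_contra hne
          exact h1.1.ne (h.unique (hcommon i j q (h2.2.1.symm.trans h1.2.1) hne)
            (hcommon i j q' (h2.2.2.symm.trans h1.2.2) hne))
        · rw [← hinr i z (x j) (by rw [hij, hyj, Sym2.eq_swap]),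
            ← hinr j z (x j) (by rw [hyj, Sym2.eq_swap])]
      · rw [← hinr i z (y j) (by rw [hij, hxj]), ← hinr j z (y j) (by rw [hxj])]
    · rintro i j k ⟨a, ha⟩ ⟨b, hb⟩ ⟨c, hc⟩ h1 h2 h3
      have h1 := hval _ _ _ _ h1
      have h2 := hval _ _ _ _ h2
      have h3 := hval _ _ _ _ h3
      simp only at h1 h2 h3
      have hloop : ∀ i w, s(x i, y i) ≠ s(w, w) := by
        intro i w hw
        rw [Sym2.eq_iff] at hw
        have hw : x i = y i := by rcases hw with ⟨h1, h2⟩ | ⟨h1, h2⟩ <;> rw [h1, h2]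
        rcases hxy i with ⟨q, q', hp, -, -, h1, h2⟩ | ⟨q, -, h1, h2, -⟩ | ⟨h1, h2, -⟩ <;>
          rw [h1, h2] at hw <;> simp at hw
        exact hp.ne hw.2
      -- A dummy label belongs to a single vertex, so two sides of a triangle meeting in it coincide
      -- and the third is a loop.
      have hside : ∀ i j z u w w', s(x i, y i) = s(Sum.inr z, u) → s(x j, y j) = s(Sum.inr z, w) →
          s(x k, y k) = w' → w' ≠ s(u, w) := by
        intro i j z u w w' h4 h5 h6 h7
        have : i = j := (hinr i z u h4).symm.trans (hinr j z w h5)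
        subst this
        rw [h4] at h5
        have : u = w := Sym2.congr_right.1 h5
        subst this
        exact hloop k u (h6.trans h7)
      rcases a with ⟨va, qa⟩ | za
      · rcases b with ⟨vb, qb⟩ | zb
        · rcases c with ⟨vc, qc⟩ | zc
          · exact not_quarterTurn_triangle (hinl _ _ _ _ _ h1).1 (hinl _ _ _ _ _ h2).1
              (hinl _ _ _ _ _ h3).1
          · replace h2 := h2.trans Sym2.eq_swap
            replace h3 := h3.trans Sym2.eq_swap
            have : j = k := (hinr _ _ _ h2).symm.trans (hinr _ _ _ h3)
            subst this
            rw [h2] at h3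
            have h4 : (Sum.inl (vb, qb) : V × ZMod 8 ⊕ V × Bool) = Sum.inl (va, qa) :=
              Sym2.congr_right.1 h3
            exact hloop i _ (h4 ▸ h1)
        · exact hside i j _ _ _ _ (h1.trans Sym2.eq_swap) h2 h3 rfl
      · have : i = k := (hinr _ _ _ h1).symm.trans (hinr _ _ _ h3)
        subst this
        rw [h1] at h3
        have h4 : b = c := Sym2.congr_right.1 h3
        subst h4
        exact hloop j _ h2
  refine ⟨_, hM, ?_⟩
  -- Chains are counted by their ends: classes entering a vertex, minus classes that also leave it.
  -- Each bond enters at most one of its endpoints, so the entering classes number at most half the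
  -- degree sum.
  let Inn : V → Finset (ZMod 8) := fun i => {q | ∃ l, B i l ∧ R q l i}
  let Pass : V → Finset (ZMod 8) := fun i => {q | (∃ l, B i l ∧ R q l i) ∧ ∃ j, B i j ∧ R q i j}
  have hT1 : #T1 + ∑ i, #(Pass i) = ∑ i, #(Inn i) := by
    have h1 : #T1 = ∑ i, #{q | (∃ l, B i l ∧ R q l i) ∧ ¬ ∃ j, B i j ∧ R q i j} := by
      simp only [T1, card_filter, Fintype.sum_prod_type]
    rw [h1, ← sum_add_distrib]
    refine sum_congr rfl fun i _ => ?_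
    rw [add_comm]
    simp only [Pass, Inn]
    rw [← filter_filter, ← filter_filter, card_filter_add_card_filter_not]
  have hT2 : #T2 + ∑ i, #(Ref i) ≤ 2 * Fintype.card V := by
    have h1 : #T2 = ∑ i, #{b : Bool | #(Ref i) = 0 ∨ (#(Ref i) ≤ 1 ∧ b = false)} := by
      simp only [T2, card_filter, Fintype.sum_prod_type]
    rw [h1, ← sum_add_distrib, mul_comm, ← Finset.card_univ, ← smul_eq_mul]
    refine sum_le_card_nsmul _ _ _ fun i _ => ?_
    have := hRef2 i
    interval_cases hc : #(Ref i)
    · simp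
    · simp only [one_ne_zero, false_or, le_refl, true_and]
      decide
    · simp
  have hInn : 2 * ∑ i, #(Inn i) ≤ ∑ i, #{j | B i j} := by
    have h1 : ∀ i, #(Inn i) ≤ #{l | B i l ∧ ∃ q, R q l i} := by
      intro i
      have hch : ∀ q : ZMod 8, ∃ l, q ∈ Inn i → B i l ∧ R q l i := by
        intro q
        by_cases hq : q ∈ Inn i
        · obtain ⟨l, hl⟩ := (mem_filter.1 hq).2
          exact ⟨l, fun _ => hl⟩
        · exact ⟨i, fun h' => absurd h' hq⟩
      choose f hf using hch
      refine card_le_card_of_injOn f ?_ ?_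
      · intro q hq
        simp only [coe_filter, mem_univ, true_and, Set.mem_ofPred_eq]
        exact ⟨(hf q hq).1, q, (hf q hq).2⟩
      · intro q hq q' hq' hqq
        have h2 := (hf q hq).2
        have h3 := (hf q' hq').2
        rw [← hqq] at h3
        exact h.unique (Or.inl h2) (Or.inl h3)
    have h2 : ∑ i, #{l | B i l ∧ ∃ q, R q l i} = ∑ i, #{l | B i l ∧ ∃ q, R q i l} := by
      simp only [card_filter]
      rw [sum_comm]
      refine sum_congr rfl fun i _ => sum_congr rfl fun j _ => ?_
      have : B j i ↔ B i j := ⟨h.symm, h.symm⟩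
      simp only [this]
    have h3 : ∀ i, #{l | B i l ∧ ∃ q, R q l i} + #{l | B i l ∧ ∃ q, R q i l} ≤ #{j | B i j} := by
      intro i
      rw [← card_union_of_disjoint]
      · refine card_le_card ?_
        intro l hl
        simp only [mem_union, mem_filter, mem_univ, true_and] at hl ⊢
        tauto
      · rw [disjoint_filter]
        rintro l - ⟨-, q, hq⟩ ⟨-, q', hq'⟩
        have : q = q' := h.unique (Or.inl hq) (Or.inr hq')
        subst this
        exact h.irrefl (h.trans hq hq')
    have h4 := sum_le_sum fun i (_ : i ∈ univ) => h1 i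
    have h5 := sum_le_sum fun i (_ : i ∈ univ) => h3 i
    rw [sum_add_distrib] at h5
    omega
  have hPass : ∑ i, #{j | B i j} ≤ ∑ i, #(Ref i) + ∑ i, #(Pass i) +
      ∑ i, #{l | B i l ∧ l ∉ Ref i ∧
          ¬ ∃ q, (R q i l ∨ R q l i) ∧ (R q i (r i l) ∨ R q (r i l) i)} := by
    rw [← sum_add_distrib, ← sum_add_distrib]
    refine sum_le_sum fun i _ => ?_
    -- A bond in the class of its reference bond must point the other way along the chain, so the
    -- chain passes through `i`. The class determines the bond, as a chain has at most two bonds at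
    -- `i`.
    have h1 : #{l | B i l ∧ l ∉ Ref i ∧
          ∃ q, (R q i l ∨ R q l i) ∧ (R q i (r i l) ∨ R q (r i l) i)} ≤ #(Pass i) := by
      have hch : ∀ l : V, ∃ q, (∃ q, (R q i l ∨ R q l i) ∧ (R q i (r i l) ∨ R q (r i l) i)) →
          (R q i l ∨ R q l i) ∧ (R q i (r i l) ∨ R q (r i l) i) := by
        intro l
        by_cases hl : ∃ q, (R q i l ∨ R q l i) ∧ (R q i (r i l) ∨ R q (r i l) i)
        · obtain ⟨q, hq⟩ := hl
          exact ⟨q, fun _ => hq⟩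
        · exact ⟨0, fun h' => absurd h' hl⟩
      choose f hf using hch
      refine card_le_card_of_injOn f ?_ ?_
      · intro l hl
        simp only [coe_filter, mem_univ, true_and, Set.mem_ofPred_eq] at hl
        obtain ⟨hB, hlR, hq⟩ := hl
        have hrR := hr i l hB hlR
        have hrB := hRefB i _ hrR
        have hne : l ≠ r i l := fun h' => hlR (h' ▸ hrR)
        obtain ⟨h2, h3⟩ := hf l hq
        simp only [coe_filter, mem_univ, true_and, Set.mem_ofPred_eq, Pass]
        rcases h2 with h2 | h2 <;> rcases h3 with h3 | h3
        · exact absurd (h.out_unique hB hrB h2 h3) hne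
        · exact ⟨⟨_, hrB, h3⟩, _, hB, h2⟩
        · exact ⟨⟨_, hB, h2⟩, _, hrB, h3⟩
        · exact absurd (h.in_unique hB hrB h2 h3) hne
      · intro l hl l' hl' hll
        simp only [coe_filter, mem_univ, true_and, Set.mem_ofPred_eq] at hl hl'
        obtain ⟨hB, hlR, hq⟩ := hl
        obtain ⟨hB', hlR', hq'⟩ := hl'
        have hrR := hr i l hB hlR
        have hrB := hRefB i _ hrR
        have hne : l ≠ r i l := fun h' => hlR (h' ▸ hrR)
        have hne' : l' ≠ r i l := fun h' => hlR' (h' ▸ hrR)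
        obtain ⟨h2, h3⟩ := hf l hq
        have h4 := (hf l' hq').1
        rw [← hll] at h4
        rcases h2 with h2 | h2 <;> rcases h4 with h4 | h4
        · exact h.out_unique hB hB' h2 h4
        · rcases h3 with h3 | h3
          · exact absurd (h.out_unique hB hrB h2 h3) hne
          · exact absurd (h.in_unique hB' hrB h4 h3) hne'
        · rcases h3 with h3 | h3
          · exact absurd (h.out_unique hB' hrB h4 h3) hne'
          · exact absurd (h.in_unique hB hrB h2 h3) hne
        · exact h.in_unique hB hB' h2 h4
    have h2 : #{j | B i j} ≤ #(Ref i ∪ ({l | B i l ∧ l ∉ Ref i ∧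
          ∃ q, (R q i l ∨ R q l i) ∧ (R q i (r i l) ∨ R q (r i l) i)} : Finset V) ∪
          ({l | B i l ∧ l ∉ Ref i ∧
          ¬ ∃ q, (R q i l ∨ R q l i) ∧ (R q i (r i l) ∨ R q (r i l) i)} : Finset V)) := by
      refine card_le_card fun l hl => ?_
      simp only [mem_union, mem_filter, mem_univ, true_and] at hl ⊢
      by_cases h3 : l ∈ Ref i
      · exact Or.inl (Or.inl h3)
      · by_cases h4 : ∃ q, (R q i l ∨ R q l i) ∧ (R q i (r i l) ∨ R q (r i l) i)
        · exact Or.inl (Or.inr ⟨hl, h3, h4⟩)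
        · exact Or.inr ⟨hl, h3, h4⟩
    refine h2.trans ((card_union_le _ _).trans (Nat.add_le_add_right ?_ _))
    exact (card_union_le _ _).trans (Nat.add_le_add_left h1 _)
  rw [card_disjSum]
  omega

end DirectionClasses

/-! ### Cones of directions in the plane -/

/-- The signed length of `u` orthogonal to the direction `α`. -/
noncomputable def crossAt (α : ℝ) (u : ℂ) : ℝ := u.im * Real.cos α - u.re * Real.sin α

theorem crossAt_eq (α : ℝ) (u : ℂ) : crossAt α u = ‖u‖ * Real.sin (u.arg - α) := by
  rw [crossAt, Real.sin_sub, ← Complex.norm_mul_cos_arg u, ← Complex.norm_mul_sin_arg u]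
  simp only [Complex.norm_mul_cos_arg, Complex.norm_mul_sin_arg]
  conv_lhs => rw [← Complex.norm_mul_cos_arg u, ← Complex.norm_mul_sin_arg u]
  ring

theorem mul_neg_iff_neg_of_pos {a b : ℝ} (ha : 0 < a) : a * b < 0 ↔ b < 0 :=
  ⟨fun h => by
    by_contra! h'
    exact absurd (mul_nonneg ha.le h') (not_le.2 h), mul_neg_of_pos_of_neg ha⟩

/-- The half-open cone of the directions `t + [q, q + 1) * π / 8`. -/
def InCone (t : ℝ) (q : ZMod 8) (u : ℂ) : Prop :=
  0 ≤ crossAt (t + q.val * (Real.pi / 8)) u ∧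
    crossAt (t + q.val * (Real.pi / 8) + Real.pi / 8) u < 0

/-- The cone is given by linear inequalities, one of them strict. Hence it is closed under sums and
omits `0`, which makes the chains strictly ordered. -/
theorem InCone.add {t : ℝ} {q : ZMod 8} {u v : ℂ} (hu : InCone t q u) (hv : InCone t q v) :
    InCone t q (u + v) := by
  have h : ∀ α, crossAt α (u + v) = crossAt α u + crossAt α v := by
    intro α
    simp only [crossAt, Complex.add_re, Complex.add_im]
    ring
  unfold InCone
  rw [h, h]
  exact ⟨add_nonneg hu.1 hv.1, add_neg hu.2 hv.2⟩

theorem InCone.ne_zero {t : ℝ} {q : ZMod 8} {u : ℂ} (hu : InCone t q u) : u ≠ 0 := by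
  rintro rfl
  simpa [crossAt] using hu.2

/-- Translates the linear description of a cone, suited to sums, into an angular one, suited to
comparing bond angles. -/
theorem sin_window_iff (x : ℝ) : (0 ≤ Real.sin x ∧ Real.sin (x - Real.pi / 8) < 0) ↔
    ∃ N : ℤ, 0 ≤ x - N * (2 * Real.pi) ∧ x - N * (2 * Real.pi) < Real.pi / 8 := by
  have hpi := Real.pi_pos
  constructor
  · rintro ⟨h1, h2⟩
    obtain ⟨N, y, hy, hxy⟩ : ∃ N : ℤ, ∃ y ∈ Set.Ico 0 (2 * Real.pi), x = y + N * (2 * Real.pi) := by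
      refine ⟨toIcoDiv Real.two_pi_pos 0 x, toIcoMod Real.two_pi_pos 0 x, ?_, ?_⟩
      · simpa using toIcoMod_mem_Ico Real.two_pi_pos 0 x
      · have := toIcoMod_add_toIcoDiv_zsmul Real.two_pi_pos 0 x
        rw [zsmul_eq_mul] at this
        exact this.symm
    have h3 : Real.sin x = Real.sin y := by rw [hxy, Real.sin_add_int_mul_two_pi]
    have h4 : Real.sin (x - Real.pi / 8) = Real.sin (y - Real.pi / 8) := by
      rw [show x - Real.pi / 8 = y - Real.pi / 8 + N * (2 * Real.pi) by rw [hxy]; ring,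
        Real.sin_add_int_mul_two_pi]
    rw [h3] at h1
    rw [h4] at h2
    have h5 : y ≤ Real.pi := by
      by_contra! h
      have := Real.sin_neg_of_neg_of_neg_pi_lt (x := y - 2 * Real.pi) (by linarith [hy.2])
        (by linarith)
      rw [Real.sin_sub_two_pi] at this
      linarith
    refine ⟨N, by linarith [hy.1], ?_⟩
    by_contra! h
    have := Real.sin_nonneg_of_nonneg_of_le_pi (x := y - Real.pi / 8) (by linarith) (by linarith)
    linarith
  · rintro ⟨N, h1, h2⟩
    constructor
    · rw [← Real.sin_sub_int_mul_two_pi x N]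
      exact Real.sin_nonneg_of_nonneg_of_le_pi h1 (by linarith)
    · rw [← Real.sin_sub_int_mul_two_pi _ N]
      exact Real.sin_neg_of_neg_of_neg_pi_lt (by linarith) (by linarith)

theorem inCone_iff {t : ℝ} {q : ZMod 8} {u : ℂ} (hu : u ≠ 0) : InCone t q u ↔
    ∃ N : ℤ, 0 ≤ u.arg - (t + q.val * (Real.pi / 8)) - N * (2 * Real.pi) ∧
      u.arg - (t + q.val * (Real.pi / 8)) - N * (2 * Real.pi) < Real.pi / 8 := by
  have hn : 0 < ‖u‖ := norm_pos_iff.2 hu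
  rw [← sin_window_iff, InCone, crossAt_eq, crossAt_eq, mul_nonneg_iff_of_pos_left hn,
    mul_neg_iff_neg_of_pos hn, sub_sub _ _ (Real.pi / 8)]

theorem inCone_neg_iff {t : ℝ} {q : ZMod 8} {u : ℂ} (hu : u ≠ 0) : InCone t q (-u) ↔
    ∃ N : ℤ, 0 ≤ u.arg + Real.pi - (t + q.val * (Real.pi / 8)) - N * (2 * Real.pi) ∧
      u.arg + Real.pi - (t + q.val * (Real.pi / 8)) - N * (2 * Real.pi) < Real.pi / 8 := by
  have hn : 0 < ‖u‖ := norm_pos_iff.2 hu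
  have h : ∀ α, crossAt α (-u) = ‖u‖ * Real.sin (u.arg + Real.pi - α) := by
    intro α
    rw [show u.arg + Real.pi - α = u.arg - α + Real.pi by ring, Real.sin_add_pi, mul_neg,
      ← crossAt_eq]
    simp only [crossAt, Complex.neg_re, Complex.neg_im]
    ring
  rw [← sin_window_iff, InCone, h, h, mul_nonneg_iff_of_pos_left hn,
    mul_neg_iff_neg_of_pos hn, sub_sub _ _ (Real.pi / 8)]

/-- A sign change turns the argument by `π`, which is eight cone widths; so the floor modulo `8`
classifies unoriented directions. -/
theorem inCone_or_neg_iff {t : ℝ} {q : ZMod 8} {u : ℂ} (hu : u ≠ 0) :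
    (InCone t q u ∨ InCone t q (-u)) ↔ ((⌊(u.arg - t) / (Real.pi / 8)⌋ : ℤ) : ZMod 8) = q := by
  have hpi : 0 < Real.pi / 8 := by have := Real.pi_pos; positivity
  have hfl : ∀ z : ℤ, ⌊(u.arg - t) / (Real.pi / 8)⌋ = z ↔
      0 ≤ u.arg - t - z * (Real.pi / 8) ∧ u.arg - t - z * (Real.pi / 8) < Real.pi / 8 := by
    intro z
    rw [Int.floor_eq_iff, le_div_iff₀ hpi, div_lt_iff₀ hpi]
    constructor <;> rintro ⟨h1, h2⟩ <;> constructor <;> linarith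
  rw [inCone_iff hu, inCone_neg_iff hu]
  have h8 : (8 : ZMod 8) = 0 := by decide
  constructor
  · rintro (⟨N, h1, h2⟩ | ⟨N, h1, h2⟩)
    · rw [(hfl (q.val + 16 * N)).2 (by push_cast; constructor <;> linarith)]
      push_cast
      rw [ZMod.natCast_zmod_val, show (16 : ZMod 8) = 0 by decide]
      simp
    · rw [(hfl (q.val + 8 * (2 * N - 1))).2 (by push_cast; constructor <;> linarith)]
      push_cast
      rw [ZMod.natCast_zmod_val, h8]
      simp
  · intro h
    have h1 : ((q.val : ℤ) : ZMod 8) = ((⌊(u.arg - t) / (Real.pi / 8)⌋ : ℤ) : ZMod 8) := by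
      rw [h]
      push_cast
      rw [ZMod.natCast_zmod_val]
    rw [ZMod.intCast_eq_intCast_iff_dvd_sub] at h1
    obtain ⟨M, hM⟩ := h1
    have h2 := (hfl (q.val + 8 * M)).1 (by push_cast at hM; omega)
    push_cast at h2
    -- The parity of the number of half turns decides between `u` and `-u`.
    rcases Int.even_or_odd' M with ⟨N, rfl | rfl⟩
    · left
      push_cast at h2
      exact ⟨N, by linarith [h2.1], by linarith [h2.2]⟩
    · right
      push_cast at h2
      exact ⟨N + 1, by push_cast; linarith [h2.1], by push_cast; linarith [h2.2]⟩

theorem exists_abs_arg_sub_lt_of_inCone {t : ℝ} {q : ZMod 8} {u v : ℂ}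
    (h : (InCone t q u ∧ InCone t q v) ∨ (InCone t q (-u) ∧ InCone t q (-v))) :
    ∃ M : ℤ, |u.arg - v.arg - M * (2 * Real.pi)| < Real.pi / 8 := by
  rcases h with ⟨hu, hv⟩ | ⟨hu, hv⟩
  · obtain ⟨N, h1, h2⟩ := (inCone_iff hu.ne_zero).1 hu
    obtain ⟨N', h3, h4⟩ := (inCone_iff hv.ne_zero).1 hv
    refine ⟨N - N', ?_⟩
    push_cast
    rw [abs_lt]
    constructor <;> linarith
  · obtain ⟨N, h1, h2⟩ := (inCone_neg_iff (neg_ne_zero.1 hu.ne_zero)).1 hu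
    obtain ⟨N', h3, h4⟩ := (inCone_neg_iff (neg_ne_zero.1 hv.ne_zero)).1 hv
    refine ⟨N - N', ?_⟩
    push_cast
    rw [abs_lt]
    constructor <;> linarith

/-- The vectors `u` and `v` are nearly orthogonal. -/
def NearlyOrthogonal (u v : ℂ) : Prop :=
  ∃ m : ℤ, Odd m ∧ |u.arg - v.arg - m * (Real.pi / 2)| ≤ 1 / 10

/-- The vectors `u` and `v` are nearly opposite, with angular defect at most `g`. -/
def NearlyOpposite (g : ℝ) (u v : ℂ) : Prop :=
  ∃ m : ℤ, Odd m ∧ |u.arg - v.arg - m * Real.pi| ≤ g ∧ |u.arg - v.arg - m * Real.pi| ≤ 1 / 10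

/-- The angle is within `1/10` of a nonzero multiple of `π/2` even modulo `2π`, and `π/2 - 1/10 >
π/8`. So two bonds at a vertex never share an oriented cone. -/
theorem pi_div_eight_le_abs_sub {u v : ℂ} {g : ℝ} (h : NearlyOrthogonal u v ∨ NearlyOpposite g u v)
    (M : ℤ) : Real.pi / 8 ≤ |u.arg - v.arg - M * (2 * Real.pi)| := by
  have hpi := Real.pi_gt_three
  by_contra! hlt
  obtain ⟨k, hk, hk'⟩ : ∃ k : ℤ, k ≠ 0 ∧
      |u.arg - v.arg - M * (2 * Real.pi) - k * (Real.pi / 2)| ≤ 1 / 10 := by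
    rcases h with ⟨m, hm, h⟩ | ⟨m, hm, -, h⟩
    · refine ⟨m - 4 * M, by obtain ⟨j, rfl⟩ := hm; omega, ?_⟩
      convert h using 2
      push_cast
      ring
    · refine ⟨2 * m - 4 * M, by obtain ⟨j, rfl⟩ := hm; omega, ?_⟩
      convert h using 2
      push_cast
      ring
  rw [abs_le] at hk'
  rw [abs_lt] at hlt
  rcases lt_or_gt_of_ne hk with h0 | h0
  · have h1 : (k : ℝ) ≤ -1 := by exact_mod_cast (by omega : k ≤ -1)
    nlinarith
  · have h1 : (1 : ℝ) ≤ k := by exact_mod_cast h0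
    nlinarith

/-- A right angle is four cone widths and the tolerance `1/10` is below one width, so the cone
indices differ by `3`, `4` or `5` modulo `8`, wherever the cones start. -/
theorem NearlyOrthogonal.quarterTurn {u v : ℂ} (h : NearlyOrthogonal u v) (t : ℝ) :
    QuarterTurn (((⌊(u.arg - t) / (Real.pi / 8)⌋ : ℤ) : ZMod 8) -
      ((⌊(v.arg - t) / (Real.pi / 8)⌋ : ℤ) : ZMod 8)) := by
  have hpi := Real.pi_gt_three
  have hpi8 : 0 < Real.pi / 8 := by positivity
  obtain ⟨m, ⟨j, rfl⟩, h⟩ := h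
  set x := (u.arg - t) / (Real.pi / 8) with hx
  set y := (v.arg - t) / (Real.pi / 8) with hy
  have hxy : |x - y - 4 * (2 * j + 1)| < 1 := by
    have : x - y - 4 * (2 * j + 1) =
        (u.arg - v.arg - ((2 * j + 1 : ℤ) : ℝ) * (Real.pi / 2)) / (Real.pi / 8) := by
      rw [hx, hy]
      field_simp
      push_cast
      ring
    rw [this, abs_div, abs_of_pos hpi8, div_lt_one hpi8]
    linarith
  rw [abs_lt] at hxy
  have h1 := Int.floor_le x
  have h2 := Int.lt_floor_add_one x
  have h3 := Int.floor_le y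
  have h4 := Int.lt_floor_add_one y
  have h5 : ⌊x⌋ - ⌊y⌋ < 8 * j + 6 := by
    have : ((⌊x⌋ - ⌊y⌋ : ℤ) : ℝ) < ((8 * j + 6 : ℤ) : ℝ) := by push_cast; linarith
    exact_mod_cast this
  have h6 : 8 * j + 2 < ⌊x⌋ - ⌊y⌋ := by
    have : ((8 * j + 2 : ℤ) : ℝ) < ((⌊x⌋ - ⌊y⌋ : ℤ) : ℝ) := by push_cast; linarith
    exact_mod_cast this
  rw [← Int.cast_sub]
  have h8 : (8 : ZMod 8) = 0 := by decide
  obtain h7 | h7 | h7 : ⌊x⌋ - ⌊y⌋ = 8 * j + 3 ∨ ⌊x⌋ - ⌊y⌋ = 8 * j + 4 ∨ ⌊x⌋ - ⌊y⌋ = 8 * j + 5 := by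
    omega
  · left; rw [h7]; push_cast; rw [h8]; simp
  · right; left; rw [h7]; push_cast; rw [h8]; simp
  · right; right; rw [h7]; push_cast; rw [h8]; simp

theorem directionClasses {V : Type*} (p : V → ℂ) (B : V → V → Prop) (g : V → V → V → ℝ)
    (hsymm : ∀ {i j}, B i j → B j i) (hne : ∀ {i j}, B i j → p j - p i ≠ 0)
    (hgood : ∀ i j k, B i j → B i k → j ≠ k → NearlyOrthogonal (p j - p i) (p k - p i) ∨
      NearlyOpposite (g i j k) (p j - p i) (p k - p i)) (t : ℝ) :
    DirectionClasses B (fun q i j => InCone t q (p j - p i)) where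
  symm := hsymm
  trans := by
    intro q i j k h1 h2
    have := h1.add h2
    rwa [sub_add_sub_cancel'] at this
  irrefl := by
    intro q i h
    exact h.ne_zero (sub_self _)
  unique := by
    intro q q' i j h1 h2
    rw [← neg_sub (p j) (p i)] at h1 h2
    have h0 : p j - p i ≠ 0 := by
      rcases h1 with h1 | h1
      · exact h1.ne_zero
      · exact neg_ne_zero.1 h1.ne_zero
    rw [inCone_or_neg_iff h0] at h1 h2
    exact h1.symm.trans h2
  exists_class := by
    intro i j h
    refine ⟨((⌊((p j - p i).arg - t) / (Real.pi / 8)⌋ : ℤ) : ZMod 8), ?_⟩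
    rw [← neg_sub (p j) (p i), inCone_or_neg_iff (hne h)]
  out_unique := by
    intro q i j k hj hk h1 h2
    by_contra hjk
    obtain ⟨M, hM⟩ := exists_abs_arg_sub_lt_of_inCone (Or.inl ⟨h1, h2⟩)
    exact absurd (pi_div_eight_le_abs_sub (hgood i j k hj hk hjk) M) (not_le.2 hM)
  in_unique := by
    intro q i j k hj hk h1 h2
    by_contra hjk
    rw [← neg_sub] at h1 h2
    obtain ⟨M, hM⟩ := exists_abs_arg_sub_lt_of_inCone (Or.inr ⟨h1, h2⟩)
    exact absurd (pi_div_eight_le_abs_sub (hgood i j k hj hk hjk) M) (not_le.2 hM)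

/-! ### Averaging over the position of a grid -/

theorem intervalIntegrable_floor_sub (y : ℝ) :
    IntervalIntegrable (fun s : ℝ => ((⌊y - s⌋ : ℤ) : ℝ)) MeasureTheory.volume 0 1 := by
  apply AntitoneOn.intervalIntegrable
  intro a _ b _ hab
  have : ⌊y - b⌋ ≤ ⌊y - a⌋ := Int.floor_mono (by linarith)
  exact Int.cast_le.2 this

/-- The fractional part has period `1`, so its mean does not feel the shift by `y`. -/
theorem integral_floor_sub (y : ℝ) :
    ∫ s in (0 : ℝ)..1, ((⌊y - s⌋ : ℤ) : ℝ) = y + ∫ s in (0 : ℝ)..1, ((⌊-s⌋ : ℤ) : ℝ) := by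
  have hfr : Function.Periodic (fun s : ℝ => Int.fract (-s)) 1 := by
    intro s
    simp only [neg_add]
    rw [← sub_eq_add_neg, Int.fract_sub_one]
  have hint : ∀ z : ℝ, IntervalIntegrable (fun s : ℝ => Int.fract (z - s))
      MeasureTheory.volume 0 1 := by
    intro z
    have h2 : IntervalIntegrable (fun s : ℝ => z - s) MeasureTheory.volume 0 1 :=
      (continuous_const.sub continuous_id).intervalIntegrable _ _
    have := h2.sub (intervalIntegrable_floor_sub z)
    exact this
  have h1 : ∀ z : ℝ, ∫ s in (0 : ℝ)..1, ((⌊z - s⌋ : ℤ) : ℝ) =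
      z - 1 / 2 - ∫ s in (0 : ℝ)..1, Int.fract (z - s) := by
    intro z
    have h2 : IntervalIntegrable (fun s : ℝ => z - s) MeasureTheory.volume 0 1 :=
      (continuous_const.sub continuous_id).intervalIntegrable _ _
    have h3 : ∫ s in (0 : ℝ)..1, ((⌊z - s⌋ : ℤ) : ℝ) =
        ∫ s in (0 : ℝ)..1, ((z - s) - Int.fract (z - s)) := by
      congr 1
      funext s
      rw [Int.self_sub_fract]
    rw [h3, intervalIntegral.integral_sub h2 (hint z)]
    congr 1
    rw [intervalIntegral.integral_sub (by simp) (by simp)]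
    simp
  have h4 : ∀ z : ℝ, ∫ s in (0 : ℝ)..1, Int.fract (z - s) = ∫ s in (0 : ℝ)..1, Int.fract (-s) := by
    intro z
    have h5 := hfr.intervalIntegral_add_eq (-z) 0
    rw [zero_add] at h5
    rw [← h5]
    have h6 := intervalIntegral.integral_comp_sub_right (a := 0) (b := 1)
      (fun s => Int.fract (-s)) z
    simp only [neg_sub] at h6
    rw [h6]
    congr 1 <;> ring
  have h7 := h1 0
  have h8 := h1 y
  simp only [zero_sub] at h7
  rw [h4] at h8
  linarith

/-- The integrand counts the points of the grid `s + ℤ` separating `x` from `y`; on average there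
are `|y - x|` of them. -/
theorem integral_abs_floor_sub_sub_floor_sub (x y : ℝ) :
    ∫ s in (0 : ℝ)..1, |((⌊y - s⌋ : ℤ) : ℝ) - ((⌊x - s⌋ : ℤ) : ℝ)| = |y - x| := by
  wlog h : x ≤ y generalizing x y
  · rw [abs_sub_comm y x, ← this y x (le_of_not_ge h)]
    simp only [abs_sub_comm]
  have h1 : ∀ s : ℝ, |((⌊y - s⌋ : ℤ) : ℝ) - ((⌊x - s⌋ : ℤ) : ℝ)| =
      ((⌊y - s⌋ : ℤ) : ℝ) - ((⌊x - s⌋ : ℤ) : ℝ) := by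
    intro s
    apply abs_of_nonneg
    have : ⌊x - s⌋ ≤ ⌊y - s⌋ := Int.floor_mono (by linarith)
    have : ((⌊x - s⌋ : ℤ) : ℝ) ≤ ((⌊y - s⌋ : ℤ) : ℝ) := by exact_mod_cast this
    linarith
  simp only [h1]
  rw [intervalIntegral.integral_sub (intervalIntegrable_floor_sub y)
    (intervalIntegrable_floor_sub x), integral_floor_sub x, integral_floor_sub y,
    abs_of_nonneg (by linarith)]
  ring

theorem exists_sum_abs_floor_sub_le {ι : Type*} (A : Finset ι) (x y : ι → ℝ) :
    ∃ s : ℝ, ∑ a ∈ A, |((⌊y a - s⌋ : ℤ) : ℝ) - ((⌊x a - s⌋ : ℤ) : ℝ)| ≤ ∑ a ∈ A, |y a - x a| := by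
  by_contra! h
  have hint : ∀ a ∈ A, IntervalIntegrable
      (fun s : ℝ => |((⌊y a - s⌋ : ℤ) : ℝ) - ((⌊x a - s⌋ : ℤ) : ℝ)|) MeasureTheory.volume 0 1 :=
    fun a _ => ((intervalIntegrable_floor_sub (y a)).sub (intervalIntegrable_floor_sub (x a))).abs
  have hsum : IntervalIntegrable
      (fun s : ℝ => ∑ a ∈ A, |((⌊y a - s⌋ : ℤ) : ℝ) - ((⌊x a - s⌋ : ℤ) : ℝ)|)
      MeasureTheory.volume 0 1 := by
    have := IntervalIntegrable.sum A hint
    rwa [sum_fn] at this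
  have h1 := intervalIntegral.intervalIntegral_pos_of_pos (a := 0) (b := 1)
    (f := fun s : ℝ => ∑ a ∈ A, |((⌊y a - s⌋ : ℤ) : ℝ) - ((⌊x a - s⌋ : ℤ) : ℝ)| -
      ∑ a ∈ A, |y a - x a|) ?_ (fun s => sub_pos.2 (h s)) one_pos
  · rw [intervalIntegral.integral_sub, intervalIntegral.integral_finsetSum hint,
      sum_congr rfl fun a _ => integral_abs_floor_sub_sub_floor_sub (x a) (y a)] at h1
    · simp at h1
    · exact hsum
    · simp
  · exact hsum.sub intervalIntegrable_const

/-! ### The edge-isoperimetric inequality with angular defect -/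

/-- Odd plus odd minus odd is odd, so an odd multiple of `π/2` would be at most `3/10` in absolute
value. -/
theorem not_nearlyOrthogonal_triangle {u v w : ℂ} (huv : NearlyOrthogonal u v)
    (hvw : NearlyOrthogonal v w) (huw : NearlyOrthogonal u w) : False := by
  obtain ⟨a, ⟨a, rfl⟩, ha⟩ := huv
  obtain ⟨b, ⟨b, rfl⟩, hb⟩ := hvw
  obtain ⟨c, ⟨c, rfl⟩, hc⟩ := huw
  have hpi := Real.pi_gt_three
  rw [abs_le] at ha hb hc
  push_cast at ha hb hc
  obtain ⟨k, hk⟩ : ∃ k : ℤ, k = a + b - c := ⟨_, rfl⟩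
  have hk' : (k : ℝ) = a + b - c := by rw [hk]; push_cast; ring
  have h1 : |((2 * k + 1 : ℤ) : ℝ) * (Real.pi / 2)| ≤ 3 / 10 := by
    push_cast
    rw [hk', abs_le]
    constructor <;> linarith [ha.1, ha.2, hb.1, hb.2, hc.1, hc.2]
  rw [abs_mul, abs_of_pos (by positivity : (0 : ℝ) < Real.pi / 2)] at h1
  have h2 : (1 : ℝ) ≤ |((2 * k + 1 : ℤ) : ℝ)| := by
    rw [← Int.cast_abs]
    have : 1 ≤ |2 * k + 1| := Int.one_le_abs (by omega)
    exact_mod_cast this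
  nlinarith

/-- The bonds at a vertex have at most two axes, represented by at most two orthogonal bonds. -/
theorem exists_axis_representatives {V : Type*} [DecidableEq V] (p : V → ℂ)
    (B : V → V → Prop) (g : V → V → V → ℝ)
    (hgood : ∀ i j k, B i j → B i k → j ≠ k → NearlyOrthogonal (p j - p i) (p k - p i) ∨
      NearlyOpposite (g i j k) (p j - p i) (p k - p i)) (i : V) :
    ∃ (Ref : Finset V) (r : V → V),
      ((∃ a b, Ref = {a, b} ∧ B i a ∧ B i b ∧ NearlyOrthogonal (p a - p i) (p b - p i)) ∨
        (∃ a, Ref = {a} ∧ B i a) ∨ Ref = ∅) ∧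
      ∀ l, B i l → l ∉ Ref → r l ∈ Ref ∧
        NearlyOpposite (g i l (r l)) (p l - p i) (p (r l) - p i) := by
  classical
  by_cases h : ∃ a b, B i a ∧ B i b ∧ NearlyOrthogonal (p a - p i) (p b - p i)
  · obtain ⟨a, b, ha, hb, hab⟩ := h
    -- A bond nearly orthogonal to `a` cannot be so to `b` as well, hence it continues `b`; any
    -- other bond continues `a`.
    refine ⟨{a, b}, fun l => if NearlyOrthogonal (p l - p i) (p a - p i) then b else a,
      Or.inl ⟨a, b, rfl, ha, hb, hab⟩, ?_⟩
    intro l hl hlab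
    simp only [mem_insert, mem_singleton, not_or] at hlab
    by_cases hla : NearlyOrthogonal (p l - p i) (p a - p i)
    · simp only [hla, if_true]
      refine ⟨by simp, (hgood i l b hl hb hlab.2).resolve_left fun hlb => ?_⟩
      exact not_nearlyOrthogonal_triangle hla hab hlb
    · simp only [hla, if_false]
      exact ⟨by simp, (hgood i l a hl ha hlab.1).resolve_left hla⟩
  · push Not at h
    by_cases h' : ∃ a, B i a
    · obtain ⟨a, ha⟩ := h'
      refine ⟨{a}, fun _ => a, Or.inr (Or.inl ⟨a, rfl, ha⟩), ?_⟩
      intro l hl hla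
      rw [mem_singleton] at hla
      exact ⟨by simp, (hgood i l a hl ha hla).resolve_left (h l a hl ha)⟩
    · push Not at h'
      exact ⟨∅, id, Or.inr (Or.inr rfl), fun l hl => absurd hl (h' l)⟩

open Classical in
/-- The edge-isoperimetric inequality for bond graphs whose bond angles are nearly multiples of
`π / 2`, up to the total angular defect `g` of the straight angles. -/
theorem ceil_two_sqrt_le_of_nearly_square {V : Type*} [Fintype V] (p : V → ℂ) (B : V → V → Prop)
    (g : V → V → V → ℝ) (hsymm : ∀ {i j}, B i j → B j i)
    (hne : ∀ {i j}, B i j → p j - p i ≠ 0) (hg0 : ∀ i j k, 0 ≤ g i j k)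
    (hgs : ∀ i j k, g i j k = g i k j)
    (hgood : ∀ i j k, B i j → B i k → j ≠ k → NearlyOrthogonal (p j - p i) (p k - p i) ∨
      NearlyOpposite (g i j k) (p j - p i) (p k - p i)) :
    (⌈2 * √(Fintype.card V : ℝ)⌉ : ℝ) ≤ 2 * Fintype.card V -
      1 / 2 * ∑ i, ∑ j, (if B i j then (1 : ℝ) else 0) +
      4 / Real.pi * ∑ i, ∑ j, ∑ k, if j ≠ k ∧ B i j ∧ B i k then g i j k else 0 := by
  have hpi := Real.pi_pos
  have hpi8 : 0 < Real.pi / 8 := by positivity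
  choose Ref r hRef hr using exists_axis_representatives p B g hgood
  have hRefB : ∀ i, ∀ l ∈ Ref i, B i l := by
    intro i l hl
    rcases hRef i with ⟨a, b, hab, ha, hb, -⟩ | ⟨a, hab, ha⟩ | hab
    · rw [hab] at hl
      simp only [mem_insert, mem_singleton] at hl
      rcases hl with rfl | rfl <;> assumption
    · rw [hab, mem_singleton] at hl
      rwa [hl]
    · simp [hab] at hl
  let A : Finset (V × V) := {a | B a.1 a.2 ∧ a.2 ∉ Ref a.1}
  have hopp : ∀ a : V × V, ∃ m : ℤ, a ∈ A → Odd m ∧ |(p a.2 - p a.1).arg -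
      (p (r a.1 a.2) - p a.1).arg - m * Real.pi| ≤ g a.1 a.2 (r a.1 a.2) := by
    intro a
    by_cases ha : a ∈ A
    · obtain ⟨h1, h2⟩ := (mem_filter.1 ha).2
      obtain ⟨m, hm, h3, -⟩ := (hr a.1 a.2 h1 h2).2
      exact ⟨m, fun _ => ⟨hm, h3⟩⟩
    · exact ⟨0, fun h => absurd h ha⟩
  choose m hm using hopp
  -- Arguments in units of the cone width. Subtracting the odd multiple of `π` turns the bond `l`
  -- back onto its reference bond, so `|y - x|` measures the defect.
  let x : V × V → ℝ := fun a => (p (r a.1 a.2) - p a.1).arg / (Real.pi / 8)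
  let y : V × V → ℝ := fun a => ((p a.2 - p a.1).arg - m a * Real.pi) / (Real.pi / 8)
  obtain ⟨s, hs⟩ := exists_sum_abs_floor_sub_le A x y
  have hyx : ∑ a ∈ A, |y a - x a| ≤ 8 / Real.pi * ∑ a ∈ A, g a.1 a.2 (r a.1 a.2) := by
    rw [mul_sum]
    refine sum_le_sum fun a ha => ?_
    have h1 : y a - x a = 8 / Real.pi *
        ((p a.2 - p a.1).arg - (p (r a.1 a.2) - p a.1).arg - m a * Real.pi) := by
      simp only [x, y]
      field_simp
      ring
    rw [h1, abs_mul, abs_of_pos (by positivity : 0 < 8 / Real.pi)]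
    exact mul_le_mul_of_nonneg_left (hm a ha).2 (by positivity)
  -- The factor `2` arises because the pair of `l` and its reference bond occurs in both orders in
  -- the triple sum, and only one of the two is a reference bond.
  have hcost : 2 * ∑ a ∈ A, g a.1 a.2 (r a.1 a.2) ≤
      ∑ i, ∑ j, ∑ k, if j ≠ k ∧ B i j ∧ B i k then g i j k else 0 := by
    have h1 : ∑ a ∈ A, g a.1 a.2 (r a.1 a.2) =
        ∑ i, ∑ l with B i l ∧ l ∉ Ref i, g i l (r i l) := by
      simp only [A, sum_filter, Fintype.sum_prod_type]
    rw [h1, mul_sum]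
    refine sum_le_sum fun i _ => ?_
    let F : V → V → ℝ := fun j k => if j ≠ k ∧ B i j ∧ B i k then g i j k else 0
    have hF : ∀ j k, 0 ≤ F j k := by
      intro j k
      simp only [F]
      split_ifs
      · exact hg0 i j k
      · exact le_rfl
    have hFs : ∀ j k, F j k = F k j := by
      intro j k
      simp only [F, hgs i j k, ne_comm (a := j), and_comm (a := B i j)]
    have hFl : ∀ l, B i l → l ∉ Ref i → F l (r i l) = g i l (r i l) := by
      intro l hl hlR
      have h2 := (hr i l hl hlR).1
      exact if_pos ⟨fun h => hlR (h ▸ h2), hl, hRefB i _ h2⟩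
    have h2 : ∑ l with B i l ∧ l ∉ Ref i, g i l (r i l) ≤
        ∑ l with B i l ∧ l ∉ Ref i, ∑ k ∈ Ref i, F l k := by
      refine sum_le_sum fun l hl => ?_
      obtain ⟨hB, hlR⟩ := (mem_filter.1 hl).2
      rw [← hFl l hB hlR]
      exact single_le_sum (fun k _ => hF l k) (hr i l hB hlR).1
    have h3 : ∑ l with B i l ∧ l ∉ Ref i, ∑ k ∈ Ref i, F l k ≤
        ∑ l with l ∉ Ref i, ∑ k, F l k := by
      refine (sum_le_sum fun l _ => sum_le_univ_sum_of_nonneg (hF l)).trans ?_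
      refine sum_le_sum_of_subset_of_nonneg ?_ fun l _ _ => sum_nonneg fun k _ => hF l k
      intro l
      simp only [mem_filter, mem_univ, true_and]
      exact And.right
    have h4 : ∑ l with B i l ∧ l ∉ Ref i, ∑ k ∈ Ref i, F l k ≤
        ∑ l with l ∈ Ref i, ∑ k, F l k := by
      rw [sum_comm, filter_mem_eq_inter, univ_inter]
      refine sum_le_sum fun k _ => ?_
      simp only [hFs _ k]
      exact sum_le_univ_sum_of_nonneg (hF k)
    have h5 := sum_filter_add_sum_filter_not univ (fun l => l ∈ Ref i) (fun l => ∑ k, F l k)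
    have h6 : ∑ j, ∑ k, (if j ≠ k ∧ B i j ∧ B i k then g i j k else 0) = ∑ l, ∑ k, F l k := rfl
    rw [h6]
    linarith
  have hdc := directionClasses p B g hsymm hne hgood (s * (Real.pi / 8))
  obtain ⟨P, hP, hP2⟩ := hdc.exists_card_bound Ref r (by
    intro i
    rcases hRef i with ⟨a, b, hab, ha, hb, hp⟩ | h
    · refine Or.inl ⟨a, b, hab, ha, hb, ?_⟩
      intro q q' hq hq'
      rw [← neg_sub (p a) (p i), inCone_or_neg_iff (hne ha)] at hq
      rw [← neg_sub (p b) (p i), inCone_or_neg_iff (hne hb)] at hq'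
      rw [← hq, ← hq']
      exact hp.quarterTurn _
    · exact Or.inr h) (fun i l h1 h2 => (hr i l h1 h2).1)
  have hK : ((∑ i, #{l | B i l ∧ l ∉ Ref i ∧
      ¬ ∃ q, (InCone (s * (Real.pi / 8)) q (p l - p i) ∨
          InCone (s * (Real.pi / 8)) q (p i - p l)) ∧
        (InCone (s * (Real.pi / 8)) q (p (r i l) - p i) ∨
          InCone (s * (Real.pi / 8)) q (p i - p (r i l)))} : ℕ) : ℝ) ≤
      ∑ a ∈ A, |((⌊y a - s⌋ : ℤ) : ℝ) - ((⌊x a - s⌋ : ℤ) : ℝ)| := by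
    have h1 : ∑ a ∈ A, |((⌊y a - s⌋ : ℤ) : ℝ) - ((⌊x a - s⌋ : ℤ) : ℝ)| =
        ∑ i, ∑ l with B i l ∧ l ∉ Ref i,
          |((⌊y (i, l) - s⌋ : ℤ) : ℝ) - ((⌊x (i, l) - s⌋ : ℤ) : ℝ)| := by
      simp only [A, sum_filter, Fintype.sum_prod_type]
    rw [h1]
    push_cast
    refine sum_le_sum fun i _ => ?_
    simp only [← and_assoc]
    rw [← filter_filter, card_filter]
    push_cast
    refine sum_le_sum fun l hl => ?_
    obtain ⟨hB, hlR⟩ := (mem_filter.1 hl).2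
    have hrB := hRefB i _ (hr i l hB hlR).1
    split_ifs with hcut
    · exact abs_nonneg _
    · rw [← Int.cast_sub, ← Int.cast_abs]
      have : 1 ≤ |⌊y (i, l) - s⌋ - ⌊x (i, l) - s⌋| := by
        -- Equal floors mean equal classes, because the removed multiple of `π` shifts the index by
        -- a multiple of `8`. So each split pair has a grid point between `x` and `y`.
        refine Int.one_le_abs fun h0 => hcut ?_
        rw [← neg_sub (p l) (p i), ← neg_sub (p (r i l)) (p i)]
        simp only [inCone_or_neg_iff (hne hB), inCone_or_neg_iff (hne hrB)]
        refine ⟨_, rfl, ?_⟩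
        have h2 : ((p l - p i).arg - s * (Real.pi / 8)) / (Real.pi / 8) =
            y (i, l) - s + ((8 * m (i, l) : ℤ) : ℝ) := by
          simp only [y]
          push_cast
          field_simp
          ring
        have h3 : ((p (r i l) - p i).arg - s * (Real.pi / 8)) / (Real.pi / 8) =
            x (i, l) - s := by
          simp only [x]
          field_simp
        rw [h2, h3, Int.floor_add_intCast, sub_eq_zero.1 h0]
        push_cast
        rw [show (8 : ZMod 8) = 0 by decide]
        simp
      exact_mod_cast this
  have hceil : ⌈2 * √(Fintype.card V : ℝ)⌉ ≤ (P : ℤ) := by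
    rw [Int.ceil_le]
    have h1 : (2 * √(Fintype.card V : ℝ)) ^ 2 ≤ (P : ℝ) ^ 2 := by
      rw [mul_pow, Real.sq_sqrt (Nat.cast_nonneg _)]
      have : ((4 * Fintype.card V : ℕ) : ℝ) ≤ ((P ^ 2 : ℕ) : ℝ) := by exact_mod_cast hP
      push_cast at this
      linarith
    push_cast
    exact abs_le_of_sq_le_sq' h1 (Nat.cast_nonneg _) |>.2
  have hceil' : (⌈2 * √(Fintype.card V : ℝ)⌉ : ℝ) ≤ P := by exact_mod_cast hceil
  have hbonds : ((∑ i, #{j | B i j} : ℕ) : ℝ) = ∑ i, ∑ j, (if B i j then (1 : ℝ) else 0) := by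
    push_cast [card_filter]
    rfl
  have hP3 := (Nat.cast_le (α := ℝ)).2 hP2
  rw [Nat.cast_add, Nat.cast_add, hbonds, Nat.cast_mul, Nat.cast_mul, Nat.cast_mul] at hP3
  push_cast at hP3 hK
  have h9 : 8 / Real.pi * ∑ a ∈ A, g a.1 a.2 (r a.1 a.2) ≤ 4 / Real.pi *
      ∑ i, ∑ j, ∑ k, if j ≠ k ∧ B i j ∧ B i k then g i j k else 0 := by
    rw [show (8 : ℝ) / Real.pi = 4 / Real.pi * 2 by ring, mul_assoc]
    exact mul_le_mul_of_nonneg_left hcost (by positivity)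
  linarith

/-! ### Clockwise angles and the potentials -/

theorem toComplex_sub (x y : Plane) : toComplex (x - y) = toComplex x - toComplex y := by
  apply Complex.ext <;> simp [toComplex]

theorem norm_toComplex (x : Plane) : ‖toComplex x‖ = ‖x‖ := by
  rw [EuclideanSpace.norm_eq, Complex.norm_def, Complex.normSq_apply]
  simp [toComplex, Fin.sum_univ_two, sq]

theorem dist_eq_norm_toComplex (x y : Plane) : dist x y = ‖toComplex x - toComplex y‖ := by
  rw [← toComplex_sub, norm_toComplex, dist_eq_norm]

theorem toComplex_injective : Function.Injective toComplex := by
  intro x y h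
  rw [← dist_eq_zero, dist_eq_norm_toComplex, h, sub_self, norm_zero]

theorem IsBond.symm {r₀ : ℝ} {x y : Plane} (h : IsBond r₀ x y) : IsBond r₀ y x :=
  ⟨h.1.symm, by rw [dist_comm]; exact h.2⟩

theorem IsBond.toComplex_sub_ne_zero {r₀ : ℝ} {x y : Plane} (h : IsBond r₀ x y) :
    toComplex y - toComplex x ≠ 0 :=
  fun h0 => h.1 (toComplex_injective (sub_eq_zero.1 h0)).symm

theorem clockwiseAngle_mem_Ico (x y z : Plane) :
    clockwiseAngle x y z ∈ Set.Ico 0 (2 * Real.pi) := by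
  have := toIcoMod_mem_Ico Real.two_pi_pos 0
    (Complex.arg (toComplex (x - y) / toComplex (z - y)))
  rwa [zero_add] at this

theorem clockwiseAngle_mem_Icc (x y z : Plane) :
    clockwiseAngle x y z ∈ Set.Icc 0 (2 * Real.pi) :=
  Set.Ico_subset_Icc_self (clockwiseAngle_mem_Ico x y z)

theorem exists_clockwiseAngle_eq {x y z : Plane} (hx : toComplex x - toComplex y ≠ 0)
    (hz : toComplex z - toComplex y ≠ 0) : ∃ N : ℤ, clockwiseAngle x y z =
      (toComplex x - toComplex y).arg - (toComplex z - toComplex y).arg + N * (2 * Real.pi) := by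
  have h := Complex.arg_div_coe_angle hx hz
  rw [← Real.Angle.coe_sub, Real.Angle.angle_eq_iff_two_pi_dvd_sub] at h
  obtain ⟨k, hk⟩ := h
  refine ⟨k - toIcoDiv Real.two_pi_pos 0
    (Complex.arg (toComplex (x - y) / toComplex (z - y))), ?_⟩
  rw [clockwiseAngle, ← self_sub_toIcoDiv_zsmul, zsmul_eq_mul]
  simp only [toComplex_sub]
  push_cast
  linear_combination hk

/-- The two angles add up to a multiple of `2π` in `[0, 4π)`. The first alternative covers equal
directions and the junk value at a zero vector. -/
theorem clockwiseAngle_swap (x y z : Plane) :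
    (clockwiseAngle x y z = 0 ∧ clockwiseAngle z y x = 0) ∨
      clockwiseAngle z y x = 2 * Real.pi - clockwiseAngle x y z := by
  have hpi := Real.pi_pos
  by_cases hx : toComplex x - toComplex y = 0
  · left
    simp [clockwiseAngle, toComplex_sub, hx]
  by_cases hz : toComplex z - toComplex y = 0
  · left
    simp [clockwiseAngle, toComplex_sub, hz]
  obtain ⟨N, hN⟩ := exists_clockwiseAngle_eq hx hz
  obtain ⟨M, hM⟩ := exists_clockwiseAngle_eq hz hx
  have h1 := clockwiseAngle_mem_Ico x y z
  have h2 := clockwiseAngle_mem_Ico z y x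
  have h3 : clockwiseAngle x y z + clockwiseAngle z y x = ((N + M : ℤ) : ℝ) * (2 * Real.pi) := by
    push_cast
    linarith
  have h4 : -1 < N + M := by
    by_contra! h
    have : ((N + M : ℤ) : ℝ) ≤ -1 := by exact_mod_cast h
    nlinarith [h1.1, h2.1]
  have h5 : N + M < 2 := by
    by_contra! h
    have : (2 : ℝ) ≤ ((N + M : ℤ) : ℝ) := by exact_mod_cast h
    nlinarith [h1.2, h2.2]
  obtain h6 | h6 : N + M = 0 ∨ N + M = 1 := by omega
  · left
    rw [h6] at h3
    push_cast at h3
    constructor <;> linarith [h1.1, h2.1]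
  · right
    rw [h6] at h3
    push_cast at h3
    linarith

/-- The angles within `ε` of a nonzero multiple of `π / 2`. -/
def goodAngles (ε : ℝ) : Set ℝ :=
  Set.Icc (Real.pi / 2 - ε) (Real.pi / 2 + ε) ∪ Set.Icc (Real.pi - ε) (Real.pi + ε) ∪
    Set.Icc (3 * Real.pi / 2 - ε) (3 * Real.pi / 2 + ε)

theorem clockwiseAngle_swap_mem_goodAngles {ε : ℝ} {x y z : Plane}
    (h : clockwiseAngle x y z ∈ goodAngles ε) : clockwiseAngle z y x ∈ goodAngles ε := by
  rcases clockwiseAngle_swap x y z with ⟨h1, h2⟩ | h1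
  · rwa [h2, ← h1]
  · rw [h1]
    rcases h with (⟨h2, h3⟩ | ⟨h2, h3⟩) | ⟨h2, h3⟩
    · right; constructor <;> linarith
    · left; right; constructor <;> linarith
    · left; left; constructor <;> linarith

namespace IsThreeBodyPotential

variable {ε : ℝ} {v₃ : ℝ → ℝ}

theorem nonneg (h : IsThreeBodyPotential ε v₃) {θ : ℝ} (hθ : θ ∈ Set.Icc (0 : ℝ) (2 * Real.pi)) :
    0 ≤ v₃ θ := by
  by_cases h1 : θ = Real.pi / 2
  · rw [h1, h.zero_half_pi]
  by_cases h2 : θ = Real.pi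
  · rw [h2, h.zero_pi]
  by_cases h3 : θ = 3 * Real.pi / 2
  · rw [h3, h.zero_three_half_pi]
  exact (h.pos θ hθ h1 h2 h3).le

theorem swap (h : IsThreeBodyPotential ε v₃) (x y z : Plane) :
    v₃ (clockwiseAngle x y z) = v₃ (clockwiseAngle z y x) := by
  rcases clockwiseAngle_swap x y z with ⟨h1, h2⟩ | h1
  · rw [h1, h2]
  · rw [h1, ← h.symm _ (clockwiseAngle_mem_Icc x y z)]

theorem gt_of_notMem (h : IsThreeBodyPotential ε v₃) (hε : 0 < ε) (hε' : ε < 1 / 100)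
    {θ : ℝ} (hθ : θ ∈ Set.Icc (0 : ℝ) (2 * Real.pi)) (hθ' : θ ∉ goodAngles ε) : 14 < v₃ θ := by
  refine lt_trans ?_ (h.large θ hθ hθ')
  -- The constant `14` comes from `4 * 1.9 ^ 2 = 14.44`.
  have h1 : (1.4 : ℝ) < √2 := by
    rw [Real.lt_sqrt (by norm_num)]
    norm_num
  have h2 : (4 : ℝ) ≤ 4 / (1 - ε) ^ 2 := by
    rw [le_div_iff₀ (by nlinarith)]
    nlinarith
  have h3 : (1.9 : ℝ) ^ 2 < (√2 + 1 / 2) ^ 2 := by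
    apply pow_lt_pow_left₀ <;> norm_num
    linarith
  nlinarith

end IsThreeBodyPotential

/-- A real-valued two-body potential of range `r₀` with minimum `-1` at `1` and a hard core. -/
structure IsRealTwoBodyPotential (ε r₀ : ℝ) (w : ℝ → ℝ) : Prop where
  min_eq : w 1 = -1
  min_unique : ∀ r : ℝ, 0 ≤ r → r ≠ 1 → -1 < w r
  range_lt_sqrt_two : r₀ < √2
  eq_zero : ∀ r : ℝ, r₀ ≤ r → w r = 0
  repulsive : ∀ r : ℝ, 0 ≤ r → r ≤ 1 - ε → ε⁻¹ < w r

theorem IsRealTwoBodyPotential.neg_one_le {ε r₀ : ℝ} {w : ℝ → ℝ}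
    (h : IsRealTwoBodyPotential ε r₀ w) {r : ℝ} (hr : 0 ≤ r) : -1 ≤ w r := by
  by_cases h1 : r = 1
  · rw [h1, h.min_eq]
  · exact (h.min_unique r hr h1).le

theorem IsRealTwoBodyPotential.range_le {ε r₀ : ℝ} {w : ℝ → ℝ}
    (h : IsRealTwoBodyPotential ε r₀ w) : r₀ < 3 / 2 := by
  refine h.range_lt_sqrt_two.trans ?_
  rw [Real.sqrt_lt' (by norm_num)]
  norm_num

/-! ### Removing a particle -/

variable {ι : Type*}

open Classical in
/-- The two-body term of the ordered pair `(i, j)`. -/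
noncomputable def pairTerm (w : ℝ → ℝ) (C : ι → Plane) (i j : ι) : ℝ :=
  if i ≠ j then w (dist (C i) (C j)) else 0

open Classical in
/-- The three-body term of the ordered triple `(i, j, k)`. -/
noncomputable def tripleTerm (v₃ : ℝ → ℝ) (r₀ : ℝ) (C : ι → Plane) (i j k : ι) : ℝ :=
  if j ≠ k ∧ IsBond r₀ (C i) (C j) ∧ IsBond r₀ (C i) (C k) then
    v₃ (clockwiseAngle (C j) (C i) (C k)) else 0

/-- The energy of the particles with indices in `S`. -/
noncomputable def subenergy (w v₃ : ℝ → ℝ) (r₀ : ℝ) (C : ι → Plane) (S : Finset ι) : ℝ :=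
  1 / 2 * ∑ i ∈ S, ∑ j ∈ S, pairTerm w C i j +
    1 / 2 * ∑ i ∈ S, ∑ j ∈ S, ∑ k ∈ S, tripleTerm v₃ r₀ C i j k

theorem pairTerm_self (w : ℝ → ℝ) (C : ι → Plane) (i : ι) : pairTerm w C i i = 0 := by
  simp [pairTerm]

theorem pairTerm_comm (w : ℝ → ℝ) (C : ι → Plane) (i j : ι) :
    pairTerm w C i j = pairTerm w C j i := by
  by_cases h : i = j
  · rw [h]
  · rw [pairTerm, pairTerm, if_pos h, if_pos (Ne.symm h), dist_comm]

theorem tripleTerm_nonneg {ε r₀ : ℝ} {v₃ : ℝ → ℝ} (h3 : IsThreeBodyPotential ε v₃)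
    (C : ι → Plane) (i j k : ι) : 0 ≤ tripleTerm v₃ r₀ C i j k := by
  unfold tripleTerm
  split_ifs
  · exact h3.nonneg (clockwiseAngle_mem_Icc _ _ _)
  · exact le_rfl

theorem sum_tripleTerm_mono {ε r₀ : ℝ} {v₃ : ℝ → ℝ} (h3 : IsThreeBodyPotential ε v₃)
    (C : ι → Plane) {S T : Finset ι} (hST : S ⊆ T) (i : ι) :
    ∑ j ∈ S, ∑ k ∈ S, tripleTerm v₃ r₀ C i j k ≤ ∑ j ∈ T, ∑ k ∈ T, tripleTerm v₃ r₀ C i j k := by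
  refine (sum_le_sum fun j _ => sum_le_sum_of_subset_of_nonneg hST
    fun k _ _ => tripleTerm_nonneg h3 C i j k).trans ?_
  exact sum_le_sum_of_subset_of_nonneg hST
    fun j _ _ => sum_nonneg fun k _ => tripleTerm_nonneg h3 C i j k

/-- Removing a particle removes at least its own pair terms and the angles at it. -/
theorem subenergy_erase_add_le [DecidableEq ι] {ε r₀ : ℝ} {v₃ : ℝ → ℝ}
    (h3 : IsThreeBodyPotential ε v₃) (w : ℝ → ℝ) (C : ι → Plane) {S : Finset ι} {i : ι}
    (hi : i ∈ S) :
    subenergy w v₃ r₀ C (S.erase i) + (∑ j ∈ S.erase i, pairTerm w C i j +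
      1 / 2 * ∑ j ∈ S, ∑ k ∈ S, tripleTerm v₃ r₀ C i j k) ≤ subenergy w v₃ r₀ C S := by
  have h1 : ∑ l ∈ S, ∑ j ∈ S, pairTerm w C l j =
      ∑ l ∈ S.erase i, ∑ j ∈ S.erase i, pairTerm w C l j + 2 * ∑ j ∈ S.erase i, pairTerm w C i j := by
    have h2 : ∀ l, ∑ j ∈ S, pairTerm w C l j =
        ∑ j ∈ S.erase i, pairTerm w C l j + pairTerm w C l i :=
      fun l => (sum_erase_add S _ hi).symm
    simp only [h2]
    rw [← sum_erase_add S _ hi, pairTerm_self, sum_add_distrib]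
    simp only [pairTerm_comm w C _ i]
    ring
  have h2 : ∑ l ∈ S.erase i, ∑ j ∈ S.erase i, ∑ k ∈ S.erase i, tripleTerm v₃ r₀ C l j k +
      ∑ j ∈ S, ∑ k ∈ S, tripleTerm v₃ r₀ C i j k ≤
      ∑ l ∈ S, ∑ j ∈ S, ∑ k ∈ S, tripleTerm v₃ r₀ C l j k := by
    rw [← sum_erase_add S (fun l => ∑ j ∈ S, ∑ k ∈ S, tripleTerm v₃ r₀ C l j k) hi]
    exact add_le_add (sum_le_sum fun l _ => sum_tripleTerm_mono h3 C (erase_subset i S) l) le_rfl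
  unfold subenergy
  linarith

/-- If each closed ball of radius `δ ≥ 3 / 4` about a particle holds at most `m` particles, then each
open ball of radius `3 / 2` about a particle holds at most `36 * m` of them. -/
theorem card_ball_le [DecidableEq ι] (C : ι → Plane) (S : Finset ι) {δ : ℝ} (hδ : 3 / 4 ≤ δ)
    {m : ℕ} (hm : ∀ j ∈ S, #{l ∈ S | dist (C j) (C l) ≤ δ} ≤ m) (i : ι) :
    #{j ∈ S | dist (C i) (C j) < 3 / 2} ≤ m * 36 := by
  have hcoord : ∀ (x y : Plane) (a : Fin 2), |x a - y a| ≤ dist x y := by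
    intro x y a
    rw [dist_eq_norm]
    exact PiLp.norm_apply_le (x - y) a
  -- Squares of side `1/2` have diameter `√2/2 < 3/4`, and `36` of them cover the ball.
  let f : ι → ℤ × ℤ := fun j => (⌊2 * (C j 0 - C i 0)⌋, ⌊2 * (C j 1 - C i 1)⌋)
  have h36 : #(Finset.Icc (-3 : ℤ) 2 ×ˢ Finset.Icc (-3 : ℤ) 2) = 36 := by decide
  rw [← h36]
  refine card_le_mul_card_image_of_maps_to (f := f) ?_ m ?_
  · intro j hj
    have hd := (mem_filter.1 hj).2
    rw [dist_comm] at hd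
    have h0 := abs_lt.1 ((hcoord (C j) (C i) 0).trans_lt hd)
    have h1 := abs_lt.1 ((hcoord (C j) (C i) 1).trans_lt hd)
    have hb : ∀ x : ℝ, -(3 / 2) < x → x < 3 / 2 → ⌊2 * x⌋ ∈ Finset.Icc (-3 : ℤ) 2 := by
      intro x h2 h3
      rw [Finset.mem_Icc]
      constructor
      · rw [Int.le_floor]
        push_cast
        linarith
      · have : ⌊2 * x⌋ < 3 := by
          rw [Int.floor_lt]
          push_cast
          linarith
        omega
    exact mem_product.2 ⟨hb _ h0.1 h0.2, hb _ h1.1 h1.2⟩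
  · intro b _
    rcases ({a ∈ {j ∈ S | dist (C i) (C j) < 3 / 2} | f a = b} : Finset ι).eq_empty_or_nonempty
      with h | ⟨j, hj⟩
    · rw [h]; simp
    · simp only [mem_filter] at hj
      refine le_trans (card_le_card ?_) (hm j hj.1.1)
      intro l hl
      simp only [mem_filter] at hl ⊢
      refine ⟨hl.1.1, le_trans ?_ hδ⟩
      have hf : f j = f l := hj.2.trans hl.2.symm
      have hc : ∀ x y : ℝ, ⌊2 * x⌋ = ⌊2 * y⌋ → (x - y) ^ 2 ≤ 1 / 4 := by
        intro x y hxy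
        have := Int.abs_sub_lt_one_of_floor_eq_floor hxy
        rw [abs_lt] at this
        nlinarith
      have h0 := hc _ _ (congrArg Prod.fst hf)
      have h1 := hc _ _ (congrArg Prod.snd hf)
      rw [EuclideanSpace.dist_eq, Fin.sum_univ_two, Real.dist_eq, Real.dist_eq, sq_abs, sq_abs]
      apply Real.sqrt_le_iff.2
      constructor
      · norm_num
      · simp only [sub_sub_sub_cancel_right] at h0 h1
        linarith

/-- Remove a particle with the largest number `m ≥ 2` of particles, itself included, within `1 - ε`.
Repulsion contributes at least `(m - 1) / ε > 100 (m - 1)`, while by maximality at most `36 m`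
particles are near enough to attract. -/
theorem exists_subenergy_erase_lt_of_close [DecidableEq ι] {ε r₀ : ℝ} {w v₃ : ℝ → ℝ}
    (hε : 0 < ε) (hε' : ε < 1 / 100)
    (h2 : IsRealTwoBodyPotential ε r₀ w) (h3 : IsThreeBodyPotential ε v₃) (C : ι → Plane)
    {S : Finset ι} {i j : ι} (hi : i ∈ S) (hj : j ∈ S) (hij : i ≠ j)
    (hd : dist (C i) (C j) ≤ 1 - ε) :
    ∃ i ∈ S, subenergy w v₃ r₀ C (S.erase i) < subenergy w v₃ r₀ C S := by
  obtain ⟨a, ha, hmax⟩ := exists_max_image S (fun a => #{l ∈ S | dist (C a) (C l) ≤ 1 - ε}) ⟨i, hi⟩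
  refine ⟨a, ha, lt_of_lt_of_le ?_ (subenergy_erase_add_le h3 w C ha)⟩
  obtain ⟨m, hm⟩ : ∃ m, m = #{l ∈ S | dist (C a) (C l) ≤ 1 - ε} := ⟨_, rfl⟩
  have hm2 : 2 ≤ m := by
    rw [hm]
    refine le_trans ?_ (hmax i hi)
    refine (card_pair hij).symm.le.trans (card_le_card ?_)
    intro l hl
    simp only [mem_insert, mem_singleton] at hl
    rw [mem_filter]
    rcases hl with rfl | rfl
    · exact ⟨hi, by rw [dist_self]; linarith⟩
    · exact ⟨hj, hd⟩
  have hball := card_ball_le C S (δ := 1 - ε) (m := m) (by linarith)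
    (fun j hj => by rw [hm]; exact hmax j hj) a
  have hclose : #{l ∈ S.erase a | dist (C a) (C l) ≤ 1 - ε} = m - 1 := by
    rw [hm, filter_erase, card_erase_of_mem]
    rw [mem_filter]
    exact ⟨ha, by rw [dist_self]; linarith⟩
  have hpair : ∑ l ∈ S.erase a, ((if dist (C a) (C l) ≤ 1 - ε then ε⁻¹ else 0) -
      (if dist (C a) (C l) < 3 / 2 then 1 else 0)) ≤ ∑ l ∈ S.erase a, pairTerm w C a l := by
    refine sum_le_sum fun l hl => ?_
    rw [pairTerm, if_pos (ne_of_mem_erase hl).symm]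
    by_cases h4 : dist (C a) (C l) ≤ 1 - ε
    · have := h2.repulsive _ dist_nonneg h4
      rw [if_pos h4]
      split_ifs <;> linarith
    · rw [if_neg h4]
      split_ifs with h5
      · linarith [h2.neg_one_le (r := dist (C a) (C l)) dist_nonneg]
      · rw [h2.eq_zero _ (by linarith [h2.range_le])]
        simp
  rw [sum_sub_distrib, ← sum_filter, sum_const, hclose, ← sum_filter, sum_const] at hpair
  have hball' : #{l ∈ S.erase a | dist (C a) (C l) < 3 / 2} ≤ m * 36 :=
    (card_le_card (filter_subset_filter _ (erase_subset a S))).trans hball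
  have h6 : ((#{l ∈ S.erase a | dist (C a) (C l) < 3 / 2} : ℕ) : ℝ) ≤ m * 36 := by
    exact_mod_cast hball'
  have h7 : (100 : ℝ) < ε⁻¹ := by
    rw [lt_inv_comm₀ (by norm_num) hε]
    linarith
  have h8 : (0 : ℝ) ≤ ∑ j ∈ S, ∑ k ∈ S, tripleTerm v₃ r₀ C a j k :=
    sum_nonneg fun j _ => sum_nonneg fun k _ => tripleTerm_nonneg h3 C a j k
  have h9 : ((m - 1 : ℕ) : ℝ) = m - 1 := by
    rw [Nat.cast_sub (by omega)]
    simp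
  have h10 : (2 : ℝ) ≤ m := by exact_mod_cast hm2
  simp only [nsmul_eq_mul, h9, mul_one] at hpair
  nlinarith

/-- A symmetric relation with a related pair in every set of five points has many related pairs. -/
theorem two_mul_card_le_card_related [DecidableEq ι] (r : ι → ι → Prop) [DecidableRel r]
    (hr : ∀ {i j}, r i j → r j i) (N : Finset ι)
    (h5 : ∀ Q ⊆ N, 5 ≤ #Q → ∃ i ∈ Q, ∃ j ∈ Q, i ≠ j ∧ r i j) :
    2 * #N ≤ ∑ i ∈ N, #{j ∈ N | i ≠ j ∧ r i j} + 8 := by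
  induction N using Finset.strongInduction with
  | H N ih =>
    -- Removing one point of a related pair loses at least two ordered pairs and lowers `2 * #N` by
    -- two; up to four points the constant `8` suffices.
    by_cases hN : 5 ≤ #N
    · obtain ⟨a, ha, b, hb, hab, hrab⟩ := h5 N Subset.rfl hN
      have h1 := ih (N.erase a) (erase_ssubset ha)
        (fun Q hQ => h5 Q (hQ.trans (erase_subset _ _)))
      have h2 : ∑ i ∈ N.erase a, #{j ∈ N.erase a | i ≠ j ∧ r i j} + 1 ≤
          ∑ i ∈ N.erase a, #{j ∈ N | i ≠ j ∧ r i j} := by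
        refine Nat.succ_le_of_lt (sum_lt_sum ?_ ⟨b, mem_erase.2 ⟨hab.symm, hb⟩, ?_⟩)
        · intro i _
          exact card_le_card (filter_subset_filter _ (erase_subset a N))
        · refine card_lt_card ⟨filter_subset_filter _ (erase_subset a N), fun hsub => ?_⟩
          have := hsub (mem_filter.2 ⟨ha, hab.symm, hr hrab⟩)
          simp at this
      have h3 : 1 ≤ #{j ∈ N | a ≠ j ∧ r a j} :=
        card_pos.2 ⟨b, mem_filter.2 ⟨hb, hab, hrab⟩⟩
      rw [← sum_erase_add N _ ha]
      rw [card_erase_of_mem ha] at h1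
      omega
    · omega

/-- Seen from one of the bonds, four others would have to fit into three windows of width `2ε`. Two
in the same window make an angle close to a multiple of `2π`, which is not good. -/
theorem exists_bad_angle_of_five_le_card [DecidableEq ι] {ε r₀ : ℝ} (hε : 0 < ε)
    (hε' : ε < 1 / 100) (C : ι → Plane) (i : ι) {Q : Finset ι}
    (hQ : ∀ j ∈ Q, IsBond r₀ (C i) (C j)) (h5 : 5 ≤ #Q) :
    ∃ j ∈ Q, ∃ k ∈ Q, j ≠ k ∧ clockwiseAngle (C j) (C i) (C k) ∉ goodAngles ε := by
  classical
  by_contra! hgood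
  have hpi := Real.pi_gt_three
  obtain ⟨a, ha⟩ : Q.Nonempty := card_pos.1 (by omega)
  let θ : ι → ℝ := fun j => clockwiseAngle (C j) (C i) (C a)
  let f : ι → Fin 3 := fun j => if θ j ∈ Set.Icc (Real.pi / 2 - ε) (Real.pi / 2 + ε) then 0 else
    if θ j ∈ Set.Icc (Real.pi - ε) (Real.pi + ε) then 1 else 2
  obtain ⟨j, hj, k, hk, hjk, hf⟩ := exists_ne_map_eq_of_card_lt_of_maps_to (s := Q.erase a)
    (t := (univ : Finset (Fin 3))) (f := f)
    (by rw [card_erase_of_mem ha, card_univ, Fintype.card_fin]; omega) (by intro _ _; simp)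
  rw [mem_erase] at hj hk
  have hclose : |θ j - θ k| ≤ 2 * ε := by
    have h1 : θ j ∈ goodAngles ε := hgood j hj.2 a ha hj.1
    have h2 : θ k ∈ goodAngles ε := hgood k hk.2 a ha hk.1
    simp only [f] at hf
    unfold goodAngles at h1 h2
    rw [abs_le]
    split_ifs at hf with h3 h4 h5 h6 h7 h8 h9
    · constructor <;> linarith [h3.1, h3.2, h4.1, h4.2]
    all_goals try (exact absurd hf (by decide))
    · constructor <;> linarith [h6.1, h6.2, h8.1, h8.2]
    · have h8 := h1.resolve_left (by simp [h3, h6])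
      have h9 := h2.resolve_left (by simp_all)
      constructor <;> linarith [h8.1, h8.2, h9.1, h9.2]
  have hbj := (hQ j hj.2).toComplex_sub_ne_zero
  have hbk := (hQ k hk.2).toComplex_sub_ne_zero
  have hba := (hQ a ha).toComplex_sub_ne_zero
  obtain ⟨N1, hN1⟩ := exists_clockwiseAngle_eq hbj hba
  obtain ⟨N2, hN2⟩ := exists_clockwiseAngle_eq hbk hba
  obtain ⟨N3, hN3⟩ := exists_clockwiseAngle_eq hbj hbk
  have h1 : clockwiseAngle (C j) (C i) (C k) - ((N3 - N1 + N2 : ℤ) : ℝ) * (2 * Real.pi) =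
      θ j - θ k := by
    simp only [θ]
    rw [hN1, hN2, hN3]
    push_cast
    ring
  rw [← h1, abs_le] at hclose
  have h2 := clockwiseAngle_mem_Ico (C j) (C i) (C k)
  have h3 := hgood j hj.2 k hk.2 hjk
  have h4 : Real.pi / 2 - ε ≤ clockwiseAngle (C j) (C i) (C k) ∧
      clockwiseAngle (C j) (C i) (C k) ≤ 3 * Real.pi / 2 + ε := by
    rcases h3 with (h3 | h3) | h3 <;> constructor <;> linarith [h3.1, h3.2]
  generalize N3 - N1 + N2 = M at hclose
  rcases le_or_gt M 0 with hM | hM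
  · have : (M : ℝ) ≤ 0 := by exact_mod_cast hM
    nlinarith
  · have : (1 : ℝ) ≤ M := by exact_mod_cast hM
    nlinarith

/-- With `X` ordered bad pairs at `i`, removal saves at least `7X` in angles and loses at most the
number of bonds, which is at most `X/2 + 4`. Since `X ≥ 2`, this is a strict gain. -/
theorem exists_subenergy_erase_lt_of_bad_angle [DecidableEq ι] {ε r₀ : ℝ} {w v₃ : ℝ → ℝ}
    (hε : 0 < ε) (hε' : ε < 1 / 100)
    (h2 : IsRealTwoBodyPotential ε r₀ w) (h3 : IsThreeBodyPotential ε v₃) (C : ι → Plane)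
    {S : Finset ι} (hS : ∀ i ∈ S, ∀ j ∈ S, i ≠ j → 1 - ε < dist (C i) (C j))
    {i j k : ι} (hi : i ∈ S) (hj : j ∈ S) (hk : k ∈ S) (hjk : j ≠ k)
    (hbj : IsBond r₀ (C i) (C j)) (hbk : IsBond r₀ (C i) (C k))
    (hbad : clockwiseAngle (C j) (C i) (C k) ∉ goodAngles ε) :
    ∃ i ∈ S, subenergy w v₃ r₀ C (S.erase i) < subenergy w v₃ r₀ C S := by
  classical
  refine ⟨i, hi, lt_of_lt_of_le ?_ (subenergy_erase_add_le h3 w C hi)⟩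
  let bad : ι → ι → Prop := fun j k => clockwiseAngle (C j) (C i) (C k) ∉ goodAngles ε
  have hbadsymm : ∀ {j k}, bad j k → bad k j :=
    fun h h' => h (clockwiseAngle_swap_mem_goodAngles h')
  let N : Finset ι := {l ∈ S | IsBond r₀ (C i) (C l)}
  have hcount := two_mul_card_le_card_related bad hbadsymm N (fun Q hQ hQ5 =>
    exists_bad_angle_of_five_le_card hε hε' C i (fun j hj => (mem_filter.1 (hQ hj)).2) hQ5)
  have hjN : j ∈ N := mem_filter.2 ⟨hj, hbj⟩
  have hkN : k ∈ N := mem_filter.2 ⟨hk, hbk⟩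
  have hcount2 : 2 ≤ ∑ i ∈ N, #{j ∈ N | i ≠ j ∧ bad i j} := by
    have h4 : ∑ i ∈ {j, k}, #{j ∈ N | i ≠ j ∧ bad i j} ≤ ∑ i ∈ N, #{j ∈ N | i ≠ j ∧ bad i j} :=
      sum_le_sum_of_subset (by
        intro l hl
        simp only [mem_insert, mem_singleton] at hl
        rcases hl with rfl | rfl <;> assumption)
    rw [sum_pair hjk] at h4
    have h5 : 1 ≤ #{l ∈ N | j ≠ l ∧ bad j l} := card_pos.2 ⟨k, mem_filter.2 ⟨hkN, hjk, hbad⟩⟩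
    have h6 : 1 ≤ #{l ∈ N | k ≠ l ∧ bad k l} :=
      card_pos.2 ⟨j, mem_filter.2 ⟨hjN, hjk.symm, hbadsymm hbad⟩⟩
    omega
  have htriple : ((∑ j ∈ N, #{k ∈ N | j ≠ k ∧ bad j k} : ℕ) : ℝ) * 14 ≤
      ∑ j ∈ S, ∑ k ∈ S, tripleTerm v₃ r₀ C i j k := by
    refine le_trans ?_ (sum_tripleTerm_mono h3 C (filter_subset _ S : N ⊆ S) i)
    push_cast
    rw [sum_mul]
    refine sum_le_sum fun j hj => ?_
    rw [card_filter]
    push_cast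
    rw [sum_mul]
    refine sum_le_sum fun k hk => ?_
    split_ifs with h4
    · rw [tripleTerm, if_pos ⟨h4.1, (mem_filter.1 hj).2, (mem_filter.1 hk).2⟩, one_mul]
      exact (h3.gt_of_notMem hε hε' (clockwiseAngle_mem_Icc _ _ _) h4.2).le
    · rw [zero_mul]
      exact tripleTerm_nonneg h3 C i j k
  have hpair : -(#N : ℝ) ≤ ∑ l ∈ S.erase i, pairTerm w C i l := by
    have h4 : #N = #{l ∈ S.erase i | IsBond r₀ (C i) (C l)} := by
      congr 1
      ext l
      simp only [N, mem_filter, mem_erase]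
      refine ⟨fun h => ⟨⟨fun h0 => h.2.1 (by rw [h0]), h.1⟩, h.2⟩, fun h => ⟨h.1.2, h.2⟩⟩
    rw [h4, card_filter]
    push_cast
    rw [← sum_neg_distrib]
    refine sum_le_sum fun l hl => ?_
    have hne := ne_of_mem_erase hl
    rw [pairTerm, if_pos hne.symm]
    split_ifs with h5
    · exact h2.neg_one_le dist_nonneg
    · have h6 : C i ≠ C l := by
        intro h6
        have := hS i hi l (mem_of_mem_erase hl) hne.symm
        rw [h6, dist_self] at this
        linarith
      have h7 : r₀ ≤ dist (C i) (C l) := by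
        by_contra! h7
        exact h5 ⟨h6, h7.le⟩
      rw [h2.eq_zero _ h7]
      simp
  have h4 : (2 * #N : ℝ) ≤ ((∑ j ∈ N, #{k ∈ N | j ≠ k ∧ bad j k} : ℕ) : ℝ) + 8 := by
    exact_mod_cast hcount
  have h5 : (2 : ℝ) ≤ ((∑ j ∈ N, #{k ∈ N | j ≠ k ∧ bad j k} : ℕ) : ℝ) := by
    exact_mod_cast hcount2
  linarith

/-! ### The lower bound and its equality case -/

/-- The minimal energy of `n` particles. -/
noncomputable def minEnergy (n : ℕ) : ℝ := -2 * (n : ℝ) + (⌈2 * √(n : ℝ)⌉ : ℝ)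

theorem minEnergy_succ_le (n : ℕ) : minEnergy (n + 1) ≤ minEnergy n := by
  have h1 : √((n + 1 : ℕ) : ℝ) ≤ √(n : ℝ) + 1 := by
    rw [Real.sqrt_le_left (by positivity)]
    have := Real.sq_sqrt (Nat.cast_nonneg (α := ℝ) n)
    push_cast
    nlinarith [Real.sqrt_nonneg (n : ℝ)]
  have h2 : ⌈2 * √((n + 1 : ℕ) : ℝ)⌉ ≤ ⌈2 * √(n : ℝ)⌉ + 2 := by
    rw [Int.ceil_le]
    push_cast at h1 ⊢
    linarith [Int.le_ceil (2 * √(n : ℝ))]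
  have h3 : (⌈2 * √((n + 1 : ℕ) : ℝ)⌉ : ℝ) ≤ ⌈2 * √(n : ℝ)⌉ + 2 := by exact_mod_cast h2
  unfold minEnergy
  push_cast at h3 ⊢
  linarith

/-- For the two ceilings `a, b ≥ 2` one has `4(m + n) ≤ a² + b² < (a + b - 1)²`. Strictness is what
excludes disconnected minimizers. -/
theorem minEnergy_add_lt {m n : ℕ} (hm : 0 < m) (hn : 0 < n) :
    minEnergy (m + n) < minEnergy m + minEnergy n := by
  have hceil : ∀ k : ℕ, 0 < k → 2 ≤ ⌈2 * √(k : ℝ)⌉ ∧ 4 * (k : ℝ) ≤ (⌈2 * √(k : ℝ)⌉ : ℝ) ^ 2 := by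
    intro k hk
    have h1 : (1 : ℝ) ≤ √(k : ℝ) := by
      rw [Real.one_le_sqrt]
      exact_mod_cast hk
    have h2 := Int.le_ceil (2 * √(k : ℝ))
    have h3 := Real.sq_sqrt (Nat.cast_nonneg (α := ℝ) k)
    refine ⟨?_, by nlinarith⟩
    have : (2 : ℝ) ≤ ⌈2 * √(k : ℝ)⌉ := by linarith
    exact_mod_cast this
  obtain ⟨ha, ha'⟩ := hceil m hm
  obtain ⟨hb, hb'⟩ := hceil n hn
  unfold minEnergy
  generalize ⌈2 * √(m : ℝ)⌉ = a at *
  generalize ⌈2 * √(n : ℝ)⌉ = b at *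
  have ha2 : (2 : ℝ) ≤ a := by exact_mod_cast ha
  have hb2 : (2 : ℝ) ≤ b := by exact_mod_cast hb
  have h1 : ⌈2 * √((m + n : ℕ) : ℝ)⌉ ≤ a + b - 1 := by
    rw [Int.ceil_le]
    push_cast
    have h2 : √((m : ℝ) + n) ≤ (a + b - 1) / 2 := by
      rw [Real.sqrt_le_left (by linarith)]
      nlinarith
    linarith
  have h2 : (⌈2 * √((m + n : ℕ) : ℝ)⌉ : ℝ) ≤ a + b - 1 := by exact_mod_cast h1
  push_cast at h2 ⊢
  linarith

/-- All bonds have length `1` and all bond angles are nonzero multiples of `π / 2`. -/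
def IsExact (r₀ : ℝ) (C : ι → Plane) (S : Finset ι) : Prop :=
  (∀ i ∈ S, ∀ j ∈ S, i ≠ j → C i ≠ C j) ∧
  (∀ i ∈ S, ∀ j ∈ S, IsBond r₀ (C i) (C j) → dist (C i) (C j) = 1) ∧
  ∀ i ∈ S, ∀ j ∈ S, ∀ k ∈ S, j ≠ k → IsBond r₀ (C i) (C j) → IsBond r₀ (C i) (C k) →
    clockwiseAngle (C j) (C i) (C k) = Real.pi / 2 ∨
    clockwiseAngle (C j) (C i) (C k) = Real.pi ∨
    clockwiseAngle (C j) (C i) (C k) = 3 * Real.pi / 2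

-- The defect is taken as `(π/6 - ε)/4 * v₃`, which dominates the deviation from `π` by the slope
-- condition. The inequality then uses at most `1/6` of the triple sum out of the available `1/2`;
-- the remaining `1/3` is kept to detect equality.
open Classical in
theorem minEnergy_le_of_good {ε r₀ : ℝ} {w v₃ : ℝ → ℝ} (hε : 0 < ε) (hε' : ε < 1 / 100)
    (h3 : IsThreeBodyPotential ε v₃) (C : ι → Plane) {S : Finset ι}
    (hangle : ∀ i ∈ S, ∀ j ∈ S, ∀ k ∈ S, j ≠ k → IsBond r₀ (C i) (C j) → IsBond r₀ (C i) (C k) →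
      clockwiseAngle (C j) (C i) (C k) ∈ goodAngles ε) :
    minEnergy #S + (1 / 2 * ∑ i ∈ S, ∑ j ∈ S,
        (pairTerm w C i j + if IsBond r₀ (C i) (C j) then (1 : ℝ) else 0) +
      1 / 3 * ∑ i ∈ S, ∑ j ∈ S, ∑ k ∈ S, tripleTerm v₃ r₀ C i j k) ≤ subenergy w v₃ r₀ C S := by
  have hpi := Real.pi_gt_three
  have hc : 0 < Real.pi / 6 - ε := by linarith
  let p : S → ℂ := fun i => toComplex (C i)
  let B : S → S → Prop := fun i j => IsBond r₀ (C i) (C j)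
  let g : S → S → S → ℝ := fun i j k =>
    (Real.pi / 6 - ε) / 4 * v₃ (clockwiseAngle (C j) (C i) (C k))
  have hcore := ceil_two_sqrt_le_of_nearly_square p B g (fun h => h.symm)
    (fun h => h.toComplex_sub_ne_zero)
    (fun i j k => mul_nonneg (by positivity) (h3.nonneg (clockwiseAngle_mem_Icc _ _ _)))
    (fun i j k => by simp only [g]; rw [h3.swap]) (by
      intro i j k hj hk hjk
      obtain ⟨N, hN⟩ := exists_clockwiseAngle_eq hj.toComplex_sub_ne_zero hk.toComplex_sub_ne_zero
      have hcong : ∀ x : ℝ, (p j - p i).arg - (p k - p i).arg - (x - N * (2 * Real.pi)) =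
          clockwiseAngle (C j) (C i) (C k) - x := by
        intro x
        rw [hN]
        ring
      rcases hangle i i.2 j j.2 k k.2 (fun h => hjk (Subtype.ext h)) hj hk with (h | h) | h
      · left
        refine ⟨1 - 4 * N, ⟨-2 * N, by ring⟩, ?_⟩
        have h4 := hcong (Real.pi / 2)
        rw [show (((1 - 4 * N : ℤ)) : ℝ) * (Real.pi / 2) = Real.pi / 2 - N * (2 * Real.pi) by
          push_cast; ring, h4, abs_le]
        constructor <;> linarith [h.1, h.2]
      · right
        have h4 := hcong Real.pi
        have h5 : |clockwiseAngle (C j) (C i) (C k) - Real.pi| ≤ ε := by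
          rw [abs_le]
          constructor <;> linarith [h.1, h.2]
        refine ⟨1 - 2 * N, ⟨-N, by ring⟩, ?_⟩
        rw [show (((1 - 2 * N : ℤ)) : ℝ) * Real.pi = Real.pi - N * (2 * Real.pi) by
          push_cast; ring, h4]
        refine ⟨?_, by linarith⟩
        have h6 := h3.slope _ h
        calc |clockwiseAngle (C j) (C i) (C k) - Real.pi| = (Real.pi / 6 - ε) / 4 *
              (4 * (Real.pi / 6 - ε)⁻¹ * |clockwiseAngle (C j) (C i) (C k) - Real.pi|) := by
              rw [← mul_assoc, ← mul_assoc, div_mul_cancel₀ _ four_ne_zero, mul_inv_cancel₀ hc.ne',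
                one_mul]
          _ ≤ _ := mul_le_mul_of_nonneg_left h6 (by positivity)
      · left
        refine ⟨3 - 4 * N, ⟨1 - 2 * N, by ring⟩, ?_⟩
        have h4 := hcong (3 * Real.pi / 2)
        rw [show (((3 - 4 * N : ℤ)) : ℝ) * (Real.pi / 2) = 3 * Real.pi / 2 - N * (2 * Real.pi) by
          push_cast; ring, h4, abs_le]
        constructor <;> linarith [h.1, h.2])
  have hB : ∑ i, ∑ j, (if B i j then (1 : ℝ) else 0) =
      ∑ i ∈ S, ∑ j ∈ S, if IsBond r₀ (C i) (C j) then (1 : ℝ) else 0 := by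
    rw [← sum_coe_sort S]
    refine sum_congr rfl fun i _ => ?_
    rw [← sum_coe_sort S]
  have hT : ∑ i, ∑ j, ∑ k, (if j ≠ k ∧ B i j ∧ B i k then g i j k else 0) =
      (Real.pi / 6 - ε) / 4 * ∑ i ∈ S, ∑ j ∈ S, ∑ k ∈ S, tripleTerm v₃ r₀ C i j k := by
    rw [← sum_coe_sort S, mul_sum]
    refine sum_congr rfl fun i _ => ?_
    rw [← sum_coe_sort S, mul_sum]
    refine sum_congr rfl fun j _ => ?_
    rw [← sum_coe_sort S, mul_sum]
    refine sum_congr rfl fun k _ => ?_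
    simp only [tripleTerm, B, g, ne_eq, Subtype.ext_iff, mul_ite, mul_zero]
  rw [hB] at hcore
  have hcore : (⌈2 * √(#S : ℝ)⌉ : ℝ) ≤ 2 * #S -
      1 / 2 * ∑ i ∈ S, ∑ j ∈ S, (if IsBond r₀ (C i) (C j) then (1 : ℝ) else 0) +
      4 / Real.pi * ((Real.pi / 6 - ε) / 4 *
        ∑ i ∈ S, ∑ j ∈ S, ∑ k ∈ S, tripleTerm v₃ r₀ C i j k) := by
    rw [← hT, ← Fintype.card_coe S]
    convert hcore
  rw [← mul_assoc] at hcore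
  have hT0 : 0 ≤ ∑ i ∈ S, ∑ j ∈ S, ∑ k ∈ S, tripleTerm v₃ r₀ C i j k :=
    sum_nonneg fun i _ => sum_nonneg fun j _ => sum_nonneg fun k _ => tripleTerm_nonneg h3 C i j k
  have hcoef : 4 / Real.pi * ((Real.pi / 6 - ε) / 4) ≤ 1 / 6 := by
    rw [div_mul_div_comm, div_le_div_iff₀ (by positivity) (by norm_num)]
    linarith
  have h6 := mul_le_mul_of_nonneg_right hcoef hT0
  simp only [sum_add_distrib]
  unfold subenergy minEnergy
  linarith

-- When no removal lowers the energy, the geometry is nearly square and the surplus in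
-- `minEnergy_le_of_good` has only nonnegative terms; equality kills each of them.
open Classical in
theorem minEnergy_le_subenergy {ε r₀ : ℝ} {w v₃ : ℝ → ℝ} (hε : 0 < ε) (hε' : ε < 1 / 100)
    (h2 : IsRealTwoBodyPotential ε r₀ w) (h3 : IsThreeBodyPotential ε v₃) (C : ι → Plane)
    (S : Finset ι) : minEnergy #S ≤ subenergy w v₃ r₀ C S ∧
      (subenergy w v₃ r₀ C S = minEnergy #S → IsExact r₀ C S) := by
  induction S using Finset.strongInduction with
  | H S ih =>
    by_cases hred : ∃ i ∈ S, subenergy w v₃ r₀ C (S.erase i) < subenergy w v₃ r₀ C S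
    · obtain ⟨i, hi, hlt⟩ := hred
      have h4 := (ih _ (erase_ssubset hi)).1
      have h5 := minEnergy_succ_le #(S.erase i)
      rw [card_erase_add_one hi] at h5
      have h6 : minEnergy #S < subenergy w v₃ r₀ C S := (h5.trans h4).trans_lt hlt
      exact ⟨h6.le, fun h => absurd h h6.ne'⟩
    have hdist : ∀ i ∈ S, ∀ j ∈ S, i ≠ j → 1 - ε < dist (C i) (C j) := by
      intro i hi j hj hij
      by_contra! hd
      exact hred (exists_subenergy_erase_lt_of_close hε hε' h2 h3 C hi hj hij hd)
    have hangle : ∀ i ∈ S, ∀ j ∈ S, ∀ k ∈ S, j ≠ k → IsBond r₀ (C i) (C j) →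
        IsBond r₀ (C i) (C k) → clockwiseAngle (C j) (C i) (C k) ∈ goodAngles ε := by
      intro i hi j hj k hk hjk hbj hbk
      by_contra hbad
      exact hred (exists_subenergy_erase_lt_of_bad_angle hε hε' h2 h3 C hdist hi hj hk hjk
        hbj hbk hbad)
    have hmain := minEnergy_le_of_good (w := w) hε hε' h3 C hangle
    have hne : ∀ i ∈ S, ∀ j ∈ S, i ≠ j → C i ≠ C j := by
      intro i hi j hj hij h
      have := hdist i hi j hj hij
      rw [h, dist_self] at this
      linarith
    have hpair : ∀ i ∈ S, ∀ j ∈ S,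
        0 ≤ pairTerm w C i j + if IsBond r₀ (C i) (C j) then (1 : ℝ) else 0 := by
      intro i hi j hj
      unfold pairTerm
      by_cases hij : i = j
      · rw [if_neg (not_not.2 hij), zero_add]
        split_ifs <;> norm_num
      · rw [if_pos hij]
        split_ifs with hb
        · linarith [h2.neg_one_le (r := dist (C i) (C j)) dist_nonneg]
        · rw [h2.eq_zero, add_zero]
          by_contra! h
          exact hb ⟨hne i hi j hj hij, h.le⟩
    have hpair0 := sum_nonneg fun i hi => sum_nonneg (hpair i hi)
    have htriple : ∀ i ∈ S, ∀ j ∈ S, 0 ≤ ∑ k ∈ S, tripleTerm v₃ r₀ C i j k :=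
      fun i _ j _ => sum_nonneg fun k _ => tripleTerm_nonneg h3 C i j k
    have htriple0 := sum_nonneg fun i hi => sum_nonneg (htriple i hi)
    refine ⟨by linarith, fun heq => ⟨hne, ?_, ?_⟩⟩
    · intro i hi j hj hb
      have h4 : ∑ i ∈ S, ∑ j ∈ S,
        (pairTerm w C i j + if IsBond r₀ (C i) (C j) then (1 : ℝ) else 0) = 0 := by linarith
      have h5 := (sum_eq_zero_iff_of_nonneg fun i hi => sum_nonneg (hpair i hi)).1 h4 i hi
      have h6 := (sum_eq_zero_iff_of_nonneg (hpair i hi)).1 h5 j hj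
      rw [if_pos hb, pairTerm, if_pos fun h => hb.1 (by rw [h])] at h6
      by_contra h1
      linarith [h2.min_unique _ dist_nonneg h1]
    · intro i hi j hj k hk hjk hbj hbk
      have h4 : ∑ i ∈ S, ∑ j ∈ S, ∑ k ∈ S, tripleTerm v₃ r₀ C i j k = 0 := by linarith
      have h5 := (sum_eq_zero_iff_of_nonneg fun i hi => sum_nonneg (htriple i hi)).1 h4 i hi
      have h6 := (sum_eq_zero_iff_of_nonneg (htriple i hi)).1 h5 j hj
      have h7 := (sum_eq_zero_iff_of_nonneg fun k _ => tripleTerm_nonneg h3 C i j k).1 h6 k hk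
      rw [tripleTerm, if_pos ⟨hjk, hbj, hbk⟩] at h7
      by_contra! hθ
      exact (h3.pos _ (clockwiseAngle_mem_Icc _ _ _) hθ.1 hθ.2.1 hθ.2.2).ne' h7

/-- Configurations of minimal energy have a connected bond graph. -/
theorem reflTransGen_bond_of_minimal [Fintype ι] {ε r₀ : ℝ} {w v₃ : ℝ → ℝ} (hε : 0 < ε)
    (hε' : ε < 1 / 100) (h2 : IsRealTwoBodyPotential ε r₀ w) (h3 : IsThreeBodyPotential ε v₃)
    (C : ι → Plane) (hmin : subenergy w v₃ r₀ C univ = minEnergy (Fintype.card ι)) (i₀ i : ι) :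
    Relation.ReflTransGen (fun i j => IsBond r₀ (C i) (C j)) i₀ i := by
  classical
  by_contra hi
  have hexact := (minEnergy_le_subenergy hε hε' h2 h3 C univ).2 hmin
  -- A connected component and its complement do not interact through `v₂`, so each would have to
  -- meet its own bound.
  let S : Finset ι := {j | Relation.ReflTransGen (fun i j => IsBond r₀ (C i) (C j)) i₀ j}
  have h0S : i₀ ∈ S := mem_filter.2 ⟨mem_univ _, Relation.ReflTransGen.refl⟩
  have hiS : i ∈ Sᶜ := by simpa [S] using hi
  have hcross : ∀ j ∈ S, ∀ k ∈ Sᶜ, pairTerm w C j k = 0 := by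
    intro j hj k hk
    have hjk : j ≠ k := fun h => (mem_compl.1 hk) (h ▸ hj)
    rw [pairTerm, if_pos hjk, h2.eq_zero]
    by_contra! hd
    refine (mem_compl.1 hk) (mem_filter.2 ⟨mem_univ _, (mem_filter.1 hj).2.tail ?_⟩)
    exact ⟨hexact.1 j (mem_univ _) k (mem_univ _) hjk, hd.le⟩
  have hpair : ∑ j, ∑ k, pairTerm w C j k =
      ∑ j ∈ S, ∑ k ∈ S, pairTerm w C j k + ∑ j ∈ Sᶜ, ∑ k ∈ Sᶜ, pairTerm w C j k := by
    rw [← sum_add_sum_compl S]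
    congr 1
    · refine sum_congr rfl fun j hj => ?_
      rw [← sum_add_sum_compl S, sum_eq_zero (hcross j hj), add_zero]
    · refine sum_congr rfl fun j hj => ?_
      rw [← sum_add_sum_compl S, add_eq_right]
      exact sum_eq_zero fun k hk => by rw [pairTerm_comm, hcross k hk j hj]
  have htriple : ∑ i ∈ S, ∑ j ∈ S, ∑ k ∈ S, tripleTerm v₃ r₀ C i j k +
      ∑ i ∈ Sᶜ, ∑ j ∈ Sᶜ, ∑ k ∈ Sᶜ, tripleTerm v₃ r₀ C i j k ≤
      ∑ i, ∑ j, ∑ k, tripleTerm v₃ r₀ C i j k := by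
    rw [← sum_add_sum_compl S (fun i => ∑ j, ∑ k, tripleTerm v₃ r₀ C i j k)]
    exact add_le_add (sum_le_sum fun i _ => sum_tripleTerm_mono h3 C (subset_univ _) i)
      (sum_le_sum fun i _ => sum_tripleTerm_mono h3 C (subset_univ _) i)
  have h4 := (minEnergy_le_subenergy hε hε' h2 h3 C S).1
  have h5 := (minEnergy_le_subenergy hε hε' h2 h3 C Sᶜ).1
  have h6 := minEnergy_add_lt (card_pos.2 ⟨i₀, h0S⟩) (card_pos.2 ⟨i, hiS⟩)
  rw [card_add_card_compl] at h6
  unfold subenergy at hmin h4 h5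
  linarith

/-! ### Exact connected configurations lie in a square lattice -/

theorem exists_eq_mul_I_pow_of_clockwiseAngle {x y z : Plane} (hx : ‖toComplex x - toComplex y‖ = 1)
    (hz : ‖toComplex z - toComplex y‖ = 1)
    (h : clockwiseAngle x y z = Real.pi / 2 ∨ clockwiseAngle x y z = Real.pi ∨
      clockwiseAngle x y z = 3 * Real.pi / 2) :
    ∃ k : ℕ, toComplex x - toComplex y = (toComplex z - toComplex y) * Complex.I ^ k := by
  obtain ⟨N, hN⟩ := exists_clockwiseAngle_eq (norm_ne_zero_iff.1 (by rw [hx]; exact one_ne_zero))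
    (norm_ne_zero_iff.1 (by rw [hz]; exact one_ne_zero))
  generalize toComplex x - toComplex y = u at *
  generalize toComplex z - toComplex y = v at *
  obtain ⟨k, hk⟩ : ∃ k : ℕ, clockwiseAngle x y z = k * (Real.pi / 2) := by
    rcases h with h | h | h
    · exact ⟨1, by rw [h]; push_cast; ring⟩
    · exact ⟨2, by rw [h]; push_cast; ring⟩
    · exact ⟨3, by rw [h]; push_cast; ring⟩
  refine ⟨k, ?_⟩
  have hu := Complex.norm_mul_exp_arg_mul_I u
  have hv := Complex.norm_mul_exp_arg_mul_I v
  have hI : Complex.I ^ k = Complex.exp (k * (Real.pi / 2 * Complex.I)) := by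
    rw [Complex.exp_nat_mul, Complex.exp_pi_div_two_mul_I]
  rw [hx, Complex.ofReal_one, one_mul] at hu
  rw [hz, Complex.ofReal_one, one_mul] at hv
  rw [← hu, ← hv, hI, ← Complex.exp_add, Complex.exp_eq_exp_iff_exists_int]
  refine ⟨-N, ?_⟩
  have h1 : u.arg = v.arg + k * (Real.pi / 2) - N * (2 * Real.pi) := by linarith
  rw [h1]
  push_cast
  ring

theorem exists_I_pow_eq (k : ℕ) : ∃ a b : ℤ, Complex.I ^ k = a + b * Complex.I := by
  induction k with
  | zero => exact ⟨1, 0, by simp⟩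
  | succ k ih =>
    obtain ⟨a, b, h⟩ := ih
    refine ⟨-b, a, ?_⟩
    rw [pow_succ, h]
    push_cast
    linear_combination (b : ℂ) * Complex.I_sq

theorem exists_isometry_mem_squareLattice [Fintype ι] {r₀ : ℝ} (C : ι → Plane)
    (hexact : IsExact r₀ C univ)
    (hconn : ∀ i₀ i, Relation.ReflTransGen (fun i j => IsBond r₀ (C i) (C j)) i₀ i) :
    ∃ g : Plane ≃ᵢ Plane, ∀ i, g (C i) ∈ squareLattice := by
  rcases isEmpty_or_nonempty ι with hι | ⟨⟨i₀⟩⟩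
  · exact ⟨IsometryEquiv.refl _, fun i => hι.elim i⟩
  obtain ⟨-, hlen, hangle⟩ := hexact
  have hlen' : ∀ i j, IsBond r₀ (C i) (C j) → ‖toComplex (C j) - toComplex (C i)‖ = 1 := by
    intro i j h
    rw [← dist_eq_norm_toComplex, dist_comm]
    exact hlen i (mem_univ _) j (mem_univ _) h
  have hdir : ∀ i j k, IsBond r₀ (C i) (C j) → IsBond r₀ (C i) (C k) → ∃ m : ℕ,
      toComplex (C j) - toComplex (C i) =
        (toComplex (C k) - toComplex (C i)) * Complex.I ^ m := by
    intro i j k hj hk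
    by_cases hjk : j = k
    · exact ⟨0, by rw [hjk, pow_zero, mul_one]⟩
    · exact exists_eq_mul_I_pow_of_clockwiseAngle (hlen' i j hj) (hlen' i k hk)
        (hangle i (mem_univ _) j (mem_univ _) k (mem_univ _) hjk hj hk)
  -- The direction `v` of some bond at the base point orients the lattice; without bonds there any
  -- unit vector does.
  obtain ⟨v, hv, hv₀⟩ : ∃ v : ℂ, ‖v‖ = 1 ∧ ∀ k, IsBond r₀ (C i₀) (C k) →
      ∃ m : ℕ, toComplex (C k) - toComplex (C i₀) = v * Complex.I ^ m := by
    by_cases h : ∃ l, IsBond r₀ (C i₀) (C l)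
    · obtain ⟨l, hl⟩ := h
      exact ⟨_, hlen' _ _ hl, fun k hk => hdir _ _ _ hk hl⟩
    · push Not at h
      exact ⟨1, norm_one, fun k hk => absurd hk (h k)⟩
  have hmain : ∀ i, (∃ a b : ℤ, toComplex (C i) - toComplex (C i₀) = v * (a + b * Complex.I)) ∧
      ∀ k, IsBond r₀ (C i) (C k) →
        ∃ m : ℕ, toComplex (C k) - toComplex (C i) = v * Complex.I ^ m := by
    intro i
    induction hconn i₀ i with
    | refl => exact ⟨⟨0, 0, by simp⟩, hv₀⟩
    | @tail j i _ hji ih =>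
      obtain ⟨⟨a, b, hab⟩, hj⟩ := ih
      obtain ⟨m, hm⟩ := hj i hji
      obtain ⟨c, d, hcd⟩ := exists_I_pow_eq m
      refine ⟨⟨a + c, b + d, ?_⟩, fun k hk => ?_⟩
      · rw [hcd] at hm
        push_cast
        linear_combination hab + hm
      · obtain ⟨l, hl⟩ := hdir i k j hk hji.symm
        -- The `2` reverses the bond from `j` to `i`, as `I ^ 2 = -1`.
        refine ⟨2 + m + l, ?_⟩
        rw [hl, pow_add, pow_add, Complex.I_sq]
        linear_combination (-Complex.I ^ l) * hm
  let e : ℂ ≃ₗᵢ[ℝ] Plane := Complex.orthonormalBasisOneI.repr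
  let c : Circle := ⟨v, mem_sphere_zero_iff_norm.2 hv⟩
  refine ⟨e.symm.toIsometryEquiv.trans ((IsometryEquiv.subRight (toComplex (C i₀))).trans
    ((rotation c⁻¹).toIsometryEquiv.trans e.toIsometryEquiv)), fun i => ?_⟩
  obtain ⟨⟨a, b, hab⟩, -⟩ := hmain i
  have hv0 : v ≠ 0 := norm_ne_zero_iff.1 (by rw [hv]; exact one_ne_zero)
  have he : e.symm (C i) = toComplex (C i) := by
    simp only [e, Complex.orthonormalBasisOneI_repr_symm_apply]
    apply Complex.ext <;> simp [toComplex]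
  have hg : (rotation c⁻¹) (e.symm (C i) - toComplex (C i₀)) = a + b * Complex.I := by
    rw [he, hab, rotation_apply, Circle.coe_inv]
    exact inv_mul_cancel_left₀ hv0 _
  have hcoord : ∀ x : Fin 2, e (a + b * Complex.I) x = ![(a : ℝ), (b : ℝ)] x := by
    intro x
    simp only [e, Complex.orthonormalBasisOneI_repr_apply]
    fin_cases x <;> simp
  intro x
  refine ⟨![a, b] x, ?_⟩
  change e ((rotation c⁻¹) (e.symm (C i) - toComplex (C i₀))) x = _
  rw [hg, hcoord]
  fin_cases x <;> simp

/-! ### Extended-valued potentials and the conclusion -/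

theorem coe_finset_sum {α : Type*} (s : Finset α) (f : α → ℝ) :
    ((∑ a ∈ s, f a : ℝ) : EReal) = ∑ a ∈ s, (f a : EReal) :=
  map_sum (⟨⟨Real.toEReal, EReal.coe_zero⟩, EReal.coe_add⟩ : ℝ →+ EReal) f s

open Classical in
/-- A real-valued minorant of a two-body potential that agrees with it where it is finite. -/
noncomputable def truncate (ε : ℝ) (v₂ : ℝ → EReal) (r : ℝ) : ℝ :=
  -- Any real above `ε⁻¹` would do: it keeps the strict repulsion bound.
  if v₂ r = ⊤ then ε⁻¹ + 1 else (v₂ r).toReal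

namespace IsTwoBodyPotential

variable {ε r₀ : ℝ} {v₂ : ℝ → EReal}

theorem ne_bot (h : IsTwoBodyPotential ε r₀ v₂) {r : ℝ} (hr : 0 ≤ r) : v₂ r ≠ ⊥ := by
  by_cases h1 : r = 1
  · rw [h1, h.min_eq]
    exact EReal.coe_ne_bot _
  · exact ((bot_le).trans_lt (h.min_unique r hr h1)).ne'

theorem truncate_le (h : IsTwoBodyPotential ε r₀ v₂) {r : ℝ} (hr : 0 ≤ r) :
    (truncate ε v₂ r : EReal) ≤ v₂ r := by
  unfold truncate
  split_ifs with h1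
  · rw [h1]
    exact le_top
  · rw [EReal.coe_toReal h1 (h.ne_bot hr)]

theorem lt_truncate (h : IsTwoBodyPotential ε r₀ v₂) {r x : ℝ} (hr : 0 ≤ r) (hx : x ≤ ε⁻¹)
    (hlt : (x : EReal) < v₂ r) : x < truncate ε v₂ r := by
  unfold truncate
  split_ifs with h1
  · linarith
  · rwa [← EReal.coe_lt_coe_iff, EReal.coe_toReal h1 (h.ne_bot hr)]

theorem isRealTwoBodyPotential (h : IsTwoBodyPotential ε r₀ v₂) (hε : 0 < ε) :
    IsRealTwoBodyPotential ε r₀ (truncate ε v₂) where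
  min_eq := by
    rw [truncate, h.min_eq, if_neg (EReal.coe_ne_top _), EReal.toReal_coe]
  min_unique r hr h1 :=
    h.lt_truncate hr (by linarith [inv_pos.2 hε]) (h.min_unique r hr h1)
  range_lt_sqrt_two := h.range_lt_sqrt_two
  eq_zero r hr := by
    rw [truncate, h.eq_zero r hr, if_neg EReal.zero_ne_top, EReal.toReal_zero]
  repulsive r hr hr' := h.lt_truncate hr le_rfl (h.repulsive r hr hr')

theorem subenergy_truncate_le_energy (h : IsTwoBodyPotential ε r₀ v₂) (v₃ : ℝ → ℝ) {n : ℕ}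
    (C : Fin n → Plane) :
    (subenergy (truncate ε v₂) v₃ r₀ C univ : EReal) ≤ energy v₂ v₃ r₀ C := by
  unfold subenergy energy
  rw [EReal.coe_add]
  have h3 : 1 / 2 * ∑ i, ∑ j, ∑ k, tripleTerm v₃ r₀ C i j k = threeBodyEnergy v₃ r₀ C := by
    unfold threeBodyEnergy tripleTerm
    congr!
  rw [h3]
  refine add_le_add ?_ le_rfl
  rw [twoBodyEnergy, EReal.coe_mul, coe_finset_sum]
  refine mul_le_mul_of_nonneg_left (sum_le_sum fun i _ => ?_) (by norm_num)
  rw [coe_finset_sum]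
  refine sum_le_sum fun j _ => ?_
  unfold pairTerm
  split_ifs
  · exact h.truncate_le dist_nonneg
  · exact le_rfl

end IsTwoBodyPotential

end Crystallization

theorem theorem1 :
    ∃ ε₀ : ℝ, 0 < ε₀ ∧ ε₀ < Real.pi / 6 ∧
      ∀ (ε r₀ : ℝ) (v₂ : ℝ → EReal) (v₃ : ℝ → ℝ), 0 < ε → ε < ε₀ →
        Crystallization.IsTwoBodyPotential ε r₀ v₂ →
        Crystallization.IsThreeBodyPotential ε v₃ →
        ∀ (n : ℕ) (C : Fin n → Crystallization.Plane),
          (((-2 * (n : ℝ) + (⌈2 * √(n : ℝ)⌉ : ℝ) : ℝ) : EReal) ≤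
              Crystallization.energy v₂ v₃ r₀ C) ∧
          (Crystallization.energy v₂ v₃ r₀ C =
              ((-2 * (n : ℝ) + (⌈2 * √(n : ℝ)⌉ : ℝ) : ℝ) : EReal) →
            ∃ g : Crystallization.Plane ≃ᵢ Crystallization.Plane,
              ∀ i, g (C i) ∈ Crystallization.squareLattice) := by
  open Crystallization in
  refine ⟨1 / 100, by norm_num, by linarith [Real.pi_gt_three], ?_⟩
  intro ε r₀ v₂ v₃ hε hε' hv₂ hv₃ n C
  have hw := hv₂.isRealTwoBodyPotential hε
  obtain ⟨hle, hexact⟩ := minEnergy_le_subenergy hε hε' hw hv₃ C Finset.univ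
  have hE := hv₂.subenergy_truncate_le_energy v₃ C
  have hn : ((-2 * (n : ℝ) + (⌈2 * √(n : ℝ)⌉ : ℝ) : ℝ) : EReal) =
      (minEnergy (Finset.univ : Finset (Fin n)).card : EReal) := by
    rw [Finset.card_univ, Fintype.card_fin, minEnergy]
  rw [hn]
  refine ⟨(EReal.coe_le_coe_iff.2 hle).trans hE, fun heq => ?_⟩
  -- Equality for the true energy squeezes the truncated energy to its minimum as well.
  rw [heq, EReal.coe_le_coe_iff] at hE
  have hmin := le_antisymm hE hle
  exact exists_isometry_mem_squareLattice C (hexact hmin)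
    (reflTransGen_bond_of_minimal hε hε' hw hv₃ C hmin)
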